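/- **Setting.** Let $\hat Y=[0,1]^3$ and let $\hat\Sigma\subset\hat Y$ be a two-dimensional inclusion: a compact set of finite area that is an embedded $C^1$ surface off a set of zero area. Let $\delta>0$, $c>0$ and $L\ge 0$. Let $\hat\tau_1,\hat\tau_2$ be measurable orthonormal tangential fields on $\hat\Sigma$. Let $\hat q:\hat Y\to\mathbb R^3$ be a deformation field: $\hat q$ is Lipschitz continuous with constant $L$ (i.e. $\hat q\in W^{1,\infty}$ with $\|\hat\nabla\hat q\|_{L^\infty}\le L$), $\hat q=0$ on $\partial\hat Y$, $\hat\tau_k\cdot\hat\nabla\hat q\in L^\infty(\hat\Sigma)$, and $y(\hat y)=\hat y+\hat q(\hat y)$ is a bijection of $\hat Y$ onto the cell $Y=[0,1]^3$; put $\Sigma=y(\hat\Sigma)$. Put $\hat F=I+\hat\nabla\hat q$, $(\hat\nabla\hat q)_{ij}=\partial_j\hat q_i$, and $\hat J=\det\hat F$, and assume $\hat J\ge\delta$ a.e. in $\hat Y$. On $\hat\Sigma$ only the tangential derivatives of $\hat q$ occur; there $\hat F$ acts on tangential vectors, $B=[\hat F\hat\tau_1\;\hat F\hat\tau_2]$ is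 the $3\times 2$ matrix with these columns, $D=B(B^TB)^{-1}$, $P=DB^T$ is the orthogonal projection onto the tangent plane of $\Sigma$, and $\kappa=\sqrt{\det(B^TB)}$ is the ratio of surface elements ($\kappa=\|\hat F^{-T}\hat\nu\|\,\hat J$, with $\hat\nu$ a unit normal of $\hat\Sigma$). Let $\varepsilon$ and $\sigma$ be measurable bounded complex $3\times3$ tensor fields on $Y$ and $\Sigma$ with symmetric real and imaginary parts, such that $\operatorname{Im}\varepsilon\,\xi\cdot\xi\ge c|\xi|^2$ for all $\xi\in\mathbb R^3$, and $\operatorname{Re}\sigma\,\xi\cdot\xi\ge c|\xi|^2$ for all real $\xi$ tangent to $\Sigma$ (almost everywhere). Let $\omega>0$. Let $\mathbf H(\hat Y,\hat\Sigma)$ be the space of the $\hat\varphi=(\hat\varphi_i)_{i=1}^3\in H^1_{\rm per}(\hat Y,\mathbb C)^3$ whose traces on $\hat\Sigma$ have weak tangential derivatives $\hat\tau_k\cdot\hat\nabla\hat\varphi_i\in L^2(\hat\Sigma,\mathbb C)$; write $\hat\nabla\hat\varphi^{T}$ for the matrix with columns $\hat\nabla\hat\varphi_i$, and $\hat\nabla_t\hat\varphi^{T}$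 for the $2\times3$ matrix of the $\hat\tau_k\cdot\hat\nabla\hat\varphi_i$. A corrector is a $\hat\chi\in\mathbf H(\hat Y,\hat\Sigma)$ such that, for all $\hat\varphi\in\mathbf H(\hat Y,\hat\Sigma)$, $$\int_{\hat Y}\varepsilon(y(\hat y))\big(I+\hat F^{-T}\hat\nabla\hat\chi^{T}\big)\cdot\big(\hat F^{-T}\overline{\hat\nabla\hat\varphi^{T}}\big)\hat J\,d\hat y-\frac1{i\omega}\int_{\hat\Sigma}\sigma(y(\hat y))\big(P+D\,\hat\nabla_t\hat\chi^{T}\big)\cdot\big(D\,\overline{\hat\nabla_t\hat\varphi^{T}}\big)\,\kappa\,d\hat o_{\hat y}=0 ,$$ where $A\cdot B=\sum_{ij}A_{ij}B_{ij}$; here $D\hat\nabla_t\hat\chi^{T}$ is the tangential projection of $\hat F^{-T}\hat\nabla\hat\chi^{T}$ onto $\Sigma$. The transformed tensors are $$\hat\varepsilon=\hat F^{-1}\varepsilon(y(\hat y))\hat F^{-T}\hat J,\qquad \hat\sigma=\sum_{m,n}\hat\sigma_{mn}\hat\tau_m\hat\tau_n^T,\qquad (\hat\sigma_{mn})=\kappa\,D^T\sigma(y(\hat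 y))D .$$ **Theorem.** There is a constant $C>0$, depending only on $\hat\Sigma$, on the lower bound $\delta$ of $\hat J$, on the ellipticity constant $c$ and on the bound $L$ for $\hat\nabla\hat q$, such that for all $\hat q,\varepsilon,\sigma,\omega$ as above the corrector $\hat\chi$, which is unique up to an additive constant vector, satisfies $$\|\hat\nabla\hat\chi\|^2_{L^2(\hat Y)}+\frac1\omega\|\hat\nabla_t\hat\chi\|^2_{L^2(\hat\Sigma)}\le C\Big(\|\hat\varepsilon\|^2_{L^\infty(\hat Y)}\|\hat F^T\|^2_{L^2(\hat Y)}+\frac1\omega\|\hat\sigma\|^2_{L^\infty(\hat\Sigma)}\|(\hat F^T)_t\|^2_{L^2(\hat\Sigma)}\Big).$$ Here $(\hat F^T)_t=B^T$ is the tangential part of $\hat F^T$ (so that $\|(\hat F^T)_t\|\le\|\hat F^T\|$), and matrices are measured in the Frobenius norm. The theorem asserts the estimate for every corrector and that two correctors differ by a constant vector a.e.; it does not assert existence. -/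

import Mathlib

open MeasureTheory Filter Topology
open scoped ENNReal NNReal Matrix

noncomputable section

/-- Three-dimensional Euclidean space. -/
abbrev E3 := EuclideanSpace ℝ (Fin 3)

/-- The Euclidean parameter plane. -/
abbrev E2 := EuclideanSpace ℝ (Fin 2)

/-- The reference unit cell `[0,1]^3`. -/
def unitCell : Set E3 := {x | ∀ i, x i ∈ Set.Icc (0 : ℝ) 1}

/-- Lebesgue measure on the unit cell. -/
def cellMeasure : Measure E3 := volume.restrict unitCell

/-- The Frobenius norm of a complex matrix. -/
def frobNorm {m n : Type*} [Fintype m] [Fintype n] (A : Matrix m n ℂ) : ℝ :=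
  Real.sqrt (∑ i, ∑ j, ‖A i j‖ ^ 2)

/-- The sesquilinear Frobenius product `∑ A_ij * conj B_ij`. -/
def frobInner {m n : Type*} [Fintype m] [Fintype n] (A B : Matrix m n ℂ) : ℂ :=
  ∑ i, ∑ j, A i j * (starRingEnd ℂ) (B i j)

/-- A real matrix regarded as a complex matrix. -/
def toComplex {m n : Type*} (A : Matrix m n ℝ) : Matrix m n ℂ := A.map (fun r : ℝ => (r : ℂ))

/-! ### Periodic Sobolev functions on the cell -/

/-- Smooth functions on `ℝ³` that are `1`-periodic in each coordinate. -/
def IsSmoothPeriodic (ψ : E3 → ℂ) : Prop :=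
  ContDiff ℝ (⊤ : ℕ∞) ψ ∧ ∀ (i : Fin 3) (x : E3), ψ (x + EuclideanSpace.single i 1) = ψ x

/-- The classical partial derivative in direction `j`. -/
def partialDeriv (j : Fin 3) (ψ : E3 → ℂ) (x : E3) : ℂ :=
  fderiv ℝ ψ x (EuclideanSpace.single j 1)

/-- `φ` belongs to `H¹_per` of the unit cell, with weak gradient `g`. Integration by parts against
all smooth periodic functions, without boundary terms, says both that `g` is the weak gradient of
`φ` in the cell and that `φ` is periodic (the traces on opposite faces agree). -/
structure HasPeriodicWeakGradient (φ : E3 → ℂ) (g : E3 → Fin 3 → ℂ) : Prop where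
  memLp : MemLp φ 2 cellMeasure
  memLp_grad : ∀ j, MemLp (fun x => g x j) 2 cellMeasure
  integral_eq : ∀ (j : Fin 3) (ψ : E3 → ℂ), IsSmoothPeriodic ψ →
    ∫ x, φ x * partialDeriv j ψ x ∂cellMeasure = - ∫ x, g x j * ψ x ∂cellMeasure

/-! ### The inclusion surface -/

/-- `X : U → S` is a regular `C¹` parametrization of a relatively open piece of `S`, and a
homeomorphism onto that piece. -/
structure IsSurfaceChart (S : Set E3) (U : Set E2) (X : E2 → E3) : Prop where
  isOpen : IsOpen U
  contDiffOn : ContDiffOn ℝ 1 X U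
  immersion : ∀ u ∈ U, Function.Injective (fderiv ℝ X u)
  injOn : Set.InjOn X U
  isOpen_image : ∀ V ⊆ U, IsOpen V → ∃ W : Set E3, IsOpen W ∧ X '' V = S ∩ W

/-- The points near which `S` is an embedded two-dimensional `C¹` surface without boundary. -/
def regularPart (S : Set E3) : Set E3 :=
  {p | ∃ (U : Set E2) (X : E2 → E3), IsSurfaceChart S U X ∧ p ∈ X '' U}

/-- Two-dimensional inclusions in the unit cell: compact sets of finite area which are embedded `C¹`
surfaces off a set of zero area (which contains the boundary curves and corners, if there are
any). -/
structure IsInclusion (S : Set E3) : Prop where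
  isCompact : IsCompact S
  subset_unitCell : S ⊆ unitCell
  finite_area : Measure.hausdorffMeasure 2 S ≠ (∞ : ℝ≥0∞)
  regular_ae : Measure.hausdorffMeasure 2 (S \ regularPart S) = (0 : ℝ≥0∞)

/-- Surface area on `S`. Mathlib's two-dimensional Hausdorff measure is built from `diam ^ 2`, hence
the normalizing factor `π / 4`, the area of a disc of diameter one. -/
def surfaceMeasure (S : Set E3) : Measure E3 :=
  ENNReal.ofReal (Real.pi / 4) • (Measure.hausdorffMeasure 2 : Measure E3).restrict S

/-- `τ 0`, `τ 1` are measurable orthonormal tangential fields on `S`. -/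
structure IsTangentFrame (S : Set E3) (τ : Fin 2 → E3 → E3) : Prop where
  measurable : ∀ k, Measurable (τ k)
  orthonormal : ∀ᵐ p ∂surfaceMeasure S, Orthonormal ℝ (fun k => τ k p)
  tangent : ∀ᵐ p ∂surfaceMeasure S, ∀ (U : Set E2) (X : E2 → E3), IsSurfaceChart S U X →
    ∀ u ∈ U, X u = p → ∀ k, ∃ v : E2, fderiv ℝ X u v = τ k p

/-- `T` is the trace on `S` of the periodic Sobolev function `φ` with weak gradient `g`: smooth
periodic functions converge to `φ` in `H¹` while their restrictions to `S` converge to `T`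
in `L²(S)`. -/
def HasTrace (S : Set E3) (φ : E3 → ℂ) (g : E3 → Fin 3 → ℂ) (T : E3 → ℂ) : Prop :=
  MemLp T 2 (surfaceMeasure S) ∧
  ∃ u : ℕ → E3 → ℂ, (∀ n, IsSmoothPeriodic (u n)) ∧
    Tendsto (fun n => eLpNorm (fun x => u n x - φ x) 2 cellMeasure) atTop (𝓝 0) ∧
    (∀ j, Tendsto (fun n => eLpNorm (fun x => partialDeriv j (u n) x - g x j) 2 cellMeasure)
      atTop (𝓝 0)) ∧
    Tendsto (fun n => eLpNorm (fun x => u n x - T x) 2 (surfaceMeasure S)) atTop (𝓝 0)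

/-- The function `T` on `S` has weak tangential derivatives `d · k = τ k · ∇ T` in `L²(S)`: in
every parametrization `X` the weak derivatives of `T ∘ X` are
`∂_α (T ∘ X) = ∑ k, (∂_α X · τ k) d_k`. -/
def HasWeakTangentialGradient (S : Set E3) (τ : Fin 2 → E3 → E3) (T : E3 → ℂ)
    (d : E3 → Fin 2 → ℂ) : Prop :=
  (∀ k, MemLp (fun p => d p k) 2 (surfaceMeasure S)) ∧
  ∀ (U : Set E2) (X : E2 → E3), IsSurfaceChart S U X →
    ∀ (α : Fin 2) (ψ : E2 → ℂ), ContDiff ℝ (⊤ : ℕ∞) ψ → HasCompactSupport ψ → tsupport ψ ⊆ U →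
      ∫ u in U, T (X u) * fderiv ℝ ψ u (EuclideanSpace.single α 1) =
        - ∫ u in U, (∑ k, ((inner ℝ (fderiv ℝ X u (EuclideanSpace.single α 1)) (τ k (X u)) : ℝ) : ℂ)
            * d (X u) k) * ψ u

/-- An element of the space `H` of the functions in `H¹_per` of the unit cell whose trace on `S` has
square integrable tangential derivatives, together with its weak gradient, its trace and the
tangential derivatives of the trace. -/
structure HFunction (S : Set E3) (τ : Fin 2 → E3 → E3) where
  /-- the function itself -/
  toFun : E3 → ℂ
  /-- its weak gradient -/
  grad : E3 → Fin 3 → ℂ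
  /-- its trace on the surface -/
  trace : E3 → ℂ
  /-- the tangential derivatives of the trace with respect to the frame -/
  tgrad : E3 → Fin 2 → ℂ
  hasGrad : HasPeriodicWeakGradient toFun grad
  hasTrace : HasTrace S toFun grad trace
  hasTgrad : HasWeakTangentialGradient S τ trace tgrad

/-- For a vector field with components in `H`: the matrix whose columns are the gradients of the
components. -/
def gradMatrix {S : Set E3} {τ : Fin 2 → E3 → E3} (χ : Fin 3 → HFunction S τ) (x : E3) :
    Matrix (Fin 3) (Fin 3) ℂ :=
  Matrix.of fun a i => (χ i).grad x a

/-- The same for the tangential gradients, in components with respect to the frame `τ`. -/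
def tgradMatrix {S : Set E3} {τ : Fin 2 → E3 → E3} (χ : Fin 3 → HFunction S τ) (p : E3) :
    Matrix (Fin 2) (Fin 3) ℂ :=
  Matrix.of fun k i => (χ i).tgrad p k

/-! ### The deformation -/

/-- The deformation `y(ŷ) = ŷ + q(ŷ)`. -/
def deform (q : E3 → E3) (x : E3) : E3 := x + q x

/-- The transformation gradient `F = I + ∇q`, with `(∇q)_ij = ∂_j q_i`. -/
def defGrad (q : E3 → E3) (x : E3) : Matrix (Fin 3) (Fin 3) ℝ :=
  Matrix.of fun i j => (if i = j then 1 else 0) + (fderiv ℝ q x (EuclideanSpace.single j 1)) i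

/-- The transformation determinant `J = det F`. -/
def defDet (q : E3 → E3) (x : E3) : ℝ := (defGrad q x).det

/-- The `3 × 2` matrix with columns `F τ_k`, on the surface. Only tangential derivatives of `q` along
`S` enter; for tangential vectors the derivative within `S` is uniquely determined. -/
def tangentMatrix (S : Set E3) (τ : Fin 2 → E3 → E3) (q : E3 → E3) (p : E3) :
    Matrix (Fin 3) (Fin 2) ℝ :=
  Matrix.of fun a k => (τ k p) a + (fderivWithin ℝ q S p (τ k p)) a

/-- For `B` with columns `F τ_k`, the columns of `B (Bᵀ B)⁻¹` are the basis of the tangent plane of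
the deformed surface dual to the `F τ_k`. -/
def dualTangentMatrix (B : Matrix (Fin 3) (Fin 2) ℝ) : Matrix (Fin 3) (Fin 2) ℝ :=
  B * (Bᵀ * B)⁻¹

/-- The ratio of the surface elements of the deformed and the reference surface,
`√det(Bᵀ B) = |F τ_0 × F τ_1|`, which is `‖F⁻ᵀ ν‖ J` by Nanson's formula. -/
def areaFactor (B : Matrix (Fin 3) (Fin 2) ℝ) : ℝ := Real.sqrt (Bᵀ * B).det

/-- Admissible deformations. A field is in `W^{1,∞}_0` of the cell if and only if it is Lipschitz
continuous and vanishes on the boundary, and its Lipschitz constant is then the essential supremum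
of the operator norm of its gradient. -/
structure IsDeformation (S : Set E3) (τ : Fin 2 → E3 → E3) (δ : ℝ) (L : ℝ≥0)
    (q : E3 → E3) : Prop where
  lipschitz : LipschitzOnWith L q unitCell
  boundary : ∀ x ∈ frontier unitCell, q x = 0
  tangential : ∀ k, MemLp (fun p => fderivWithin ℝ q S p (τ k p)) ∞ (surfaceMeasure S)
  bijOn : Set.BijOn (deform q) unitCell unitCell
  le_det : ∀ᵐ x ∂cellMeasure, δ ≤ defDet q x

/-! ### Material tensors and the cell problem -/

/-- The (bulk) permittivity `ε`, as a tensor on the deformed cell: bounded, with symmetric real and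
imaginary parts, the imaginary part being uniformly elliptic with constant `c`. -/
structure IsPermittivity (c : ℝ) (q : E3 → E3) (ε : E3 → Matrix (Fin 3) (Fin 3) ℂ) : Prop where
  measurable : ∀ i j, Measurable fun y => ε y i j
  bounded : ∃ M : ℝ, ∀ᵐ x ∂cellMeasure, frobNorm (ε (deform q x)) ≤ M
  symm : ∀ᵐ x ∂cellMeasure, (ε (deform q x)).IsSymm
  elliptic : ∀ᵐ x ∂cellMeasure, ∀ ξ : Fin 3 → ℝ,
    c * (ξ ⬝ᵥ ξ) ≤ ξ ⬝ᵥ ((ε (deform q x)).map Complex.im *ᵥ ξ)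

/-- The surface conductivity `σ`, as a tensor on the deformed surface: bounded, with symmetric real
and imaginary parts, the real part being uniformly elliptic with constant `c` on the tangent planes
of the deformed surface. -/
structure IsConductivity (c : ℝ) (S : Set E3) (τ : Fin 2 → E3 → E3) (q : E3 → E3)
    (σ : E3 → Matrix (Fin 3) (Fin 3) ℂ) : Prop where
  measurable : ∀ i j, Measurable fun y => σ y i j
  bounded : ∃ M : ℝ, ∀ᵐ p ∂surfaceMeasure S, frobNorm (σ (deform q p)) ≤ M
  symm : ∀ᵐ p ∂surfaceMeasure S, (σ (deform q p)).IsSymm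
  elliptic : ∀ᵐ p ∂surfaceMeasure S, ∀ ξ : Fin 3 → ℝ,
    (∃ a : Fin 2 → ℝ, ξ = tangentMatrix S τ q p *ᵥ a) →
      c * (ξ ⬝ᵥ ξ) ≤ ξ ⬝ᵥ ((σ (deform q p)).map Complex.re *ᵥ ξ)

/-- The form `E(χ, φ; q)` of the deformed cell problem. In the surface term, with `B` the matrix of
the `F τ_k` and `D = B (Bᵀ B)⁻¹`, the matrix `D * Bᵀ` is the orthogonal projection of the unit
matrix onto the tangent plane of the deformed surface, and `D * tgradMatrix χ` has as its columns
the tangential gradients of the components of `χ` on the deformed surface, that is, the tangential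
projections of `F⁻ᵀ ∇χ_i`. -/
def cellForm (ω : ℝ) (ε σ : E3 → Matrix (Fin 3) (Fin 3) ℂ) (S : Set E3) (τ : Fin 2 → E3 → E3)
    (q : E3 → E3) (χ φ : Fin 3 → HFunction S τ) : ℂ :=
  (∫ x, frobInner
      (ε (deform q x) * (1 + toComplex (defGrad q x)⁻¹ᵀ * gradMatrix χ x))
      (toComplex (defGrad q x)⁻¹ᵀ * gradMatrix φ x) * (defDet q x : ℂ) ∂cellMeasure)
  - 1 / (Complex.I * (ω : ℂ)) *
    ∫ p, frobInner
      (σ (deform q p) *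
        (toComplex (dualTangentMatrix (tangentMatrix S τ q p) * (tangentMatrix S τ q p)ᵀ)
          + toComplex (dualTangentMatrix (tangentMatrix S τ q p)) * tgradMatrix χ p))
      (toComplex (dualTangentMatrix (tangentMatrix S τ q p)) * tgradMatrix φ p)
      * (areaFactor (tangentMatrix S τ q p) : ℂ) ∂surfaceMeasure S

/-- `χ` is a corrector: it solves the deformed cell problem. -/
def IsCorrector (ω : ℝ) (ε σ : E3 → Matrix (Fin 3) (Fin 3) ℂ) (S : Set E3) (τ : Fin 2 → E3 → E3)
    (q : E3 → E3) (χ : Fin 3 → HFunction S τ) : Prop :=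
  ∀ φ : Fin 3 → HFunction S τ, cellForm ω ε σ S τ q χ φ = 0

/-- The transformed permittivity `F⁻¹ ε(y(ŷ)) F⁻ᵀ J`. -/
def hatPermittivity (ε : E3 → Matrix (Fin 3) (Fin 3) ℂ) (q : E3 → E3) (x : E3) :
    Matrix (Fin 3) (Fin 3) ℂ :=
  (defDet q x : ℂ) •
    (toComplex (defGrad q x)⁻¹ * ε (deform q x) * toComplex (defGrad q x)⁻¹ᵀ)

/-- The coefficients, with respect to the orthonormal frame `τ`, of the transformed conductivity
`∑ σ̂_mn τ_m τ_nᵀ`. With `τ'_m = F τ_m / ‖F τ_m‖` and the tangential part of `σ(y(ŷ))` expanded as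
`∑ σ_mn τ'_m τ'_nᵀ`, one has `Dᵀ σ D = (σ_mn / (‖F τ_m‖ ‖F τ_n‖))_mn`. -/
def hatConductivity (σ : E3 → Matrix (Fin 3) (Fin 3) ℂ) (S : Set E3) (τ : Fin 2 → E3 → E3)
    (q : E3 → E3) (p : E3) : Matrix (Fin 2) (Fin 2) ℂ :=
  (areaFactor (tangentMatrix S τ q p) : ℂ) •
    ((toComplex (dualTangentMatrix (tangentMatrix S τ q p)))ᵀ * σ (deform q p) *
      toComplex (dualTangentMatrix (tangentMatrix S τ q p)))

/-- `L^r` norm of a matrix field, pointwise with the Frobenius norm. -/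
def matrixNorm {m n : Type*} [Fintype m] [Fintype n] (A : E3 → Matrix m n ℂ) (r : ℝ≥0∞)
    (μ : Measure E3) : ℝ≥0∞ :=
  eLpNorm (fun x => frobNorm (A x)) r μ

end

/-! Multiplied by `-i`, the cell form becomes a sum of two energies on the reference cell and
surface, with tensors `-i ε̂` and `σ̂` and weights `1` and `1/ω`
(`IsDeformation.neg_I_mul_cellForm`). The unit matrix and the projection are `F⁻ᵀ Fᵀ` and `D Bᵀ`, so
the inhomogeneities pull back to `Fᵀ` and `Bᵀ`. The real part of `-i ε` is `Im ε`, so both energies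
have coercive real parts. Testing with `χ` itself and applying Young's inequality (`energy_le`)
gives the estimate with `C = 1/γ²`, where `γ` is a common coercivity constant.

What has to be shown is that `γ` depends on `c`, `δ`, `L` only. In the bulk, `|ξ| ≤ (1+L)|F⁻ᵀ ξ|`
and `J ≥ δ` give `c δ/(1+L)²`. On the surface a lower bound for `κ` is needed, but the a.e. bound on
`J` says nothing on a set of volume zero. The way out is a quantitative fact about the map itself:
the inverse of the deformation is Lipschitz with a constant depending on `δ` and `L` only
(`IsDeformation.dist_le`). This follows from a volume count along the preimage of a segment
(`dist_le_of_volume_le`) and holds between all pairs of points, so it can be differentiated along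
curves in the surface (`IsDeformation.norm_tangent_bounds`); it bounds `B` from below, hence also
`κ`.

For uniqueness, coercivity applied to the difference of two correctors makes its weak gradient
vanish. A periodic function with zero weak gradient has no nonconstant Fourier modes
(`HasPeriodicWeakGradient.ae_eq_const`). -/

/-! ### Frobenius product and pointwise coercivity of complex matrices -/

section MatrixAlgebra

variable {l m n : Type*} [Fintype l] [Fintype m] [Fintype n]

theorem frobNorm_nonneg (A : Matrix m n ℂ) : 0 ≤ frobNorm A := Real.sqrt_nonneg _

theorem frobNorm_sq (A : Matrix m n ℂ) : frobNorm A ^ 2 = ∑ i, ∑ j, ‖A i j‖ ^ 2 :=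
  Real.sq_sqrt (by positivity)

open scoped Matrix.Norms.Frobenius in
theorem frobNorm_eq_norm (A : Matrix m n ℂ) : frobNorm A = ‖A‖ := by
  rw [Matrix.frobenius_norm_def, frobNorm, Real.sqrt_eq_rpow]
  simp

theorem frobNorm_mul_le (A : Matrix l m ℂ) (B : Matrix m n ℂ) :
    frobNorm (A * B) ≤ frobNorm A * frobNorm B := by
  simp only [frobNorm_eq_norm]
  exact Matrix.frobenius_norm_mul A B

theorem norm_entry_le_frobNorm (A : Matrix m n ℂ) (i : m) (j : n) : ‖A i j‖ ≤ frobNorm A := by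
  apply Real.le_sqrt_of_sq_le
  calc ‖A i j‖ ^ 2 ≤ ∑ j, ‖A i j‖ ^ 2 :=
        Finset.single_le_sum (f := fun j => ‖A i j‖ ^ 2) (fun _ _ => by positivity)
          (Finset.mem_univ j)
    _ ≤ ∑ i, ∑ j, ‖A i j‖ ^ 2 :=
        Finset.single_le_sum (f := fun i => ∑ j, ‖A i j‖ ^ 2) (fun _ _ => by positivity)
          (Finset.mem_univ i)

theorem norm_frobInner_le (A B : Matrix m n ℂ) :
    ‖frobInner A B‖ ≤ frobNorm A * frobNorm B := by
  have h1 : ‖frobInner A B‖ ≤ ∑ p : m × n, ‖A p.1 p.2‖ * ‖B p.1 p.2‖ := by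
    rw [frobInner, Fintype.sum_prod_type]
    refine (norm_sum_le _ _).trans (Finset.sum_le_sum fun i _ => (norm_sum_le _ _).trans ?_)
    exact Finset.sum_le_sum fun j _ => by simp
  refine h1.trans ((Real.sum_mul_le_sqrt_mul_sqrt _ _ _).trans (le_of_eq ?_))
  simp only [frobNorm, Fintype.sum_prod_type]

theorem frobInner_add_left (A A' B : Matrix m n ℂ) :
    frobInner (A + A') B = frobInner A B + frobInner A' B := by
  simp [frobInner, add_mul, Finset.sum_add_distrib]

theorem frobInner_smul_left (z : ℂ) (A B : Matrix m n ℂ) :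
    frobInner (z • A) B = z * frobInner A B := by
  simp [frobInner, Finset.mul_sum, mul_assoc]

/-- Conjugation does not affect a real factor, so its adjoint is the plain transpose. This is what
turns the deformed form into one with a pulled back tensor. -/
theorem frobInner_toComplex_mul_right (A : Matrix l n ℂ) (T : Matrix l m ℝ) (B : Matrix m n ℂ) :
    frobInner A (toComplex T * B) = frobInner ((toComplex T)ᵀ * A) B := by
  simp only [frobInner, Matrix.mul_apply, map_sum, map_mul, toComplex, Matrix.map_apply,
    Matrix.transpose_apply, Complex.conj_ofReal, Finset.mul_sum, Finset.sum_mul]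
  rw [Finset.sum_comm]
  conv_rhs => rw [Finset.sum_comm]
  refine Finset.sum_congr rfl fun j _ => ?_
  rw [Finset.sum_comm]
  refine Finset.sum_congr rfl fun i _ => Finset.sum_congr rfl fun k _ => ?_
  ring

omit [Fintype l] [Fintype n] in
theorem toComplex_mul (A : Matrix l m ℝ) (B : Matrix m n ℝ) :
    toComplex (A * B) = toComplex A * toComplex B :=
  Matrix.map_mul (f := Complex.ofRealHom)

omit [Fintype m] [Fintype n] in
theorem toComplex_transpose (A : Matrix m n ℝ) : (toComplex A)ᵀ = toComplex Aᵀ := rfl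

omit [Fintype m] in
theorem toComplex_one [DecidableEq m] : toComplex (1 : Matrix m m ℝ) = 1 := by
  ext i j
  by_cases h : i = j <;> simp [toComplex, h, Matrix.one_apply]

/-- A symmetric complex matrix whose real part is bounded below on real vectors is bounded below
on complex matrices. -/
theorem le_re_frobInner_of_isSymm {A : Matrix m m ℂ} {α : ℝ} (hA : A.IsSymm)
    (h : ∀ ξ : m → ℝ, α * (ξ ⬝ᵥ ξ) ≤ ξ ⬝ᵥ (A.map Complex.re *ᵥ ξ)) (G : Matrix m n ℂ) :
    α * frobNorm G ^ 2 ≤ (frobInner (A * G) G).re := by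
  have key : (frobInner (A * G) G).re = ∑ k,
      ((fun i => (G i k).re) ⬝ᵥ (A.map Complex.re *ᵥ fun i => (G i k).re)
        + (fun i => (G i k).im) ⬝ᵥ (A.map Complex.re *ᵥ fun i => (G i k).im)) := by
    rw [frobInner, Finset.sum_comm, Complex.re_sum]
    refine Finset.sum_congr rfl fun k _ => ?_
    -- `Im A` enters the real part only against an expression antisymmetric in `i, j`; symmetry of
    -- `A` cancels it. The real and imaginary parts of each column of `G` then decouple.
    have hanti : ∑ i, ∑ j, (A i j).im * ((G j k).im * (G i k).re - (G j k).re * (G i k).im)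
        = 0 := by
      have h1 : ∑ i, ∑ j, (A i j).im * ((G j k).im * (G i k).re)
          = ∑ i, ∑ j, (A i j).im * ((G j k).re * (G i k).im) := by
        rw [Finset.sum_comm]
        refine Finset.sum_congr rfl fun i _ => Finset.sum_congr rfl fun j _ => ?_
        rw [hA.apply i j]
        ring
      simp only [mul_sub, Finset.sum_sub_distrib]
      rw [h1, sub_self]
    simp only [Complex.re_sum, Matrix.mul_apply, dotProduct, Matrix.mulVec, Finset.sum_mul,
      Finset.mul_sum, Matrix.map_apply]
    rw [← Finset.sum_add_distrib, eq_comm, ← sub_zero (∑ i, _), ← hanti, ← Finset.sum_sub_distrib]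
    refine Finset.sum_congr rfl fun i _ => ?_
    rw [← Finset.sum_add_distrib, ← Finset.sum_sub_distrib]
    refine Finset.sum_congr rfl fun j _ => ?_
    simp [Complex.mul_re, Complex.mul_im]
    ring
  have hnorm : frobNorm G ^ 2 = ∑ k, ((fun i => (G i k).re) ⬝ᵥ (fun i => (G i k).re)
        + (fun i => (G i k).im) ⬝ᵥ (fun i => (G i k).im)) := by
    rw [frobNorm_sq, Finset.sum_comm]
    refine Finset.sum_congr rfl fun k _ => ?_
    simp only [dotProduct, ← Finset.sum_add_distrib]
    refine Finset.sum_congr rfl fun i _ => ?_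
    rw [← Complex.normSq_eq_norm_sq, Complex.normSq_apply]
  rw [key, hnorm, Finset.mul_sum]
  refine Finset.sum_le_sum fun k _ => ?_
  rw [mul_add]
  exact add_le_add (h _) (h _)

/-- The pointwise energy inequality for a coercive matrix. -/
theorem le_re_frobInner_add {A : Matrix m m ℂ} {α : ℝ} (hα : 0 < α) (M G : Matrix m n ℂ)
    (h : α * frobNorm G ^ 2 ≤ (frobInner (A * G) G).re) :
    α / 2 * frobNorm G ^ 2 - 1 / (2 * α) * (frobNorm A ^ 2 * frobNorm M ^ 2)
      ≤ (frobInner (A * (M + G)) G).re := by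
  have h1 : |(frobInner (A * M) G).re| ≤ frobNorm A * frobNorm M * frobNorm G :=
    (Complex.abs_re_le_norm _).trans ((norm_frobInner_le _ _).trans
      (mul_le_mul_of_nonneg_right (frobNorm_mul_le _ _) (frobNorm_nonneg _)))
  have h2 := (abs_le.1 h1).1
  rw [Matrix.mul_add, frobInner_add_left, Complex.add_re]
  have h3 : frobNorm A * frobNorm M * frobNorm G
      ≤ α / 2 * frobNorm G ^ 2 + 1 / (2 * α) * (frobNorm A ^ 2 * frobNorm M ^ 2) := by
    -- Young's inequality, weighted so that exactly half of the coercivity is spent on the cross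
    -- term.
    have : 0 ≤ (α * frobNorm G - frobNorm A * frobNorm M) ^ 2 / (2 * α) := by positivity
    have e : (α * frobNorm G - frobNorm A * frobNorm M) ^ 2 / (2 * α)
      = α / 2 * frobNorm G ^ 2 + 1 / (2 * α) * (frobNorm A ^ 2 * frobNorm M ^ 2)
        - frobNorm A * frobNorm M * frobNorm G := by
      field_simp
      ring
    linarith
  linarith

end MatrixAlgebra

/-! ### Matrix fields in `L^r` and the integrated energy inequality -/

section Energy

variable {l m n : Type*} [Fintype l] [Fintype m] [Fintype n] {μ : Measure E3}

/-- A matrix field with entries in `L^r`. -/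
def MatrixMemLp (G : E3 → Matrix m n ℂ) (r : ℝ≥0∞) (μ : Measure E3) : Prop :=
  ∀ i j, MemLp (fun x => G x i j) r μ

theorem aestronglyMeasurable_frobNorm {G : E3 → Matrix m n ℂ}
    (hG : ∀ i j, AEStronglyMeasurable (fun x => G x i j) μ) :
    AEStronglyMeasurable (fun x => frobNorm (G x)) μ := by
  unfold frobNorm
  exact Real.continuous_sqrt.comp_aestronglyMeasurable
    (Finset.aestronglyMeasurable_fun_sum _ fun i _ =>
      Finset.aestronglyMeasurable_fun_sum _ fun j _ => (hG i j).norm.pow 2)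

theorem MatrixMemLp.memLp_frobNorm {r : ℝ≥0∞} {G : E3 → Matrix m n ℂ} (hG : MatrixMemLp G r μ) :
    MemLp (fun x => frobNorm (G x)) r μ := by
  have h : MemLp (fun x => ∑ i, ∑ j, ‖G x i j‖) r μ :=
    memLp_finsetSum _ fun i _ => memLp_finsetSum _ fun j _ => (hG i j).norm
  refine h.mono (aestronglyMeasurable_frobNorm fun i j => (hG i j).1) (ae_of_all _ fun x => ?_)
  rw [Real.norm_of_nonneg (frobNorm_nonneg _), Real.norm_of_nonneg (by positivity)]
  refine Real.sqrt_le_iff.2 ⟨by positivity, ?_⟩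
  have := Finset.sum_sq_le_sq_sum_of_nonneg (s := (Finset.univ : Finset (m × n)))
    (f := fun p => ‖G x p.1 p.2‖) (fun _ _ => norm_nonneg _)
  simpa only [Fintype.sum_prod_type] using this

omit [Fintype m] [Fintype n] in
theorem MatrixMemLp.add {r : ℝ≥0∞} {G H : E3 → Matrix m n ℂ} (hG : MatrixMemLp G r μ)
    (hH : MatrixMemLp H r μ) : MatrixMemLp (fun x => G x + H x) r μ :=
  fun i j => (hG i j).add (hH i j)

omit [Fintype m] [Fintype n] in
theorem MatrixMemLp.const_smul {r : ℝ≥0∞} {G : E3 → Matrix m n ℂ} (hG : MatrixMemLp G r μ)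
    (z : ℂ) : MatrixMemLp (fun x => z • G x) r μ :=
  fun i j => (hG i j).const_mul z

omit [Fintype l] [Fintype n] in
theorem MatrixMemLp.mul {r : ℝ≥0∞} {A : E3 → Matrix l m ℂ} {G : E3 → Matrix m n ℂ}
    (hA : MatrixMemLp A ∞ μ) (hG : MatrixMemLp G r μ) :
    MatrixMemLp (fun x => A x * G x) r μ := fun i j => by
  simp only [Matrix.mul_apply]
  exact memLp_finsetSum _ fun k _ => (hG k j).mul (hA i k)

theorem MatrixMemLp.of_bound {G : E3 → Matrix m n ℂ}
    (hm : ∀ i j, AEStronglyMeasurable (fun x => G x i j) μ) {K : ℝ}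
    (hb : ∀ᵐ x ∂μ, frobNorm (G x) ≤ K) : MatrixMemLp G ∞ μ := fun i j =>
  memLp_top_of_bound (hm i j) K (hb.mono fun _ hx => (norm_entry_le_frobNorm _ i j).trans hx)

theorem integrable_frobInner {G H : E3 → Matrix m n ℂ} (hG : MatrixMemLp G 2 μ)
    (hH : MatrixMemLp H 2 μ) : Integrable (fun x => frobInner (G x) (H x)) μ := by
  unfold frobInner
  refine integrable_finsetSum _ fun i _ => integrable_finsetSum _ fun j _ => ?_
  exact (hG i j).integrable_mul (hH i j).star

/-- Passes from extended norms to real integrals, in which the energy estimate is linear arithmetic.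
-/
theorem matrixNorm_two_sq {G : E3 → Matrix m n ℂ} (hG : MatrixMemLp G 2 μ) :
    matrixNorm G 2 μ ^ 2 = ENNReal.ofReal (∫ x, frobNorm (G x) ^ 2 ∂μ) := by
  have h := hG.memLp_frobNorm.eLpNorm_eq_integral_rpow_norm (by norm_num) (by norm_num)
  rw [matrixNorm, h, ← ENNReal.ofReal_pow (by positivity)]
  congr 1
  have hnn : 0 ≤ ∫ x, frobNorm (G x) ^ 2 ∂μ := integral_nonneg fun _ => by positivity
  simp only [ENNReal.toReal_ofNat, Real.rpow_ofNat, Real.norm_eq_abs, sq_abs]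
  rw [← Real.rpow_natCast, ← Real.rpow_mul hnn]
  norm_num

/-- The energy inequality for a coercive field of matrices. -/
theorem energy_le {A : E3 → Matrix m m ℂ} {M G : E3 → Matrix m n ℂ} {α : ℝ} (hα : 0 < α)
    (hA : MatrixMemLp A ∞ μ) (hM : MatrixMemLp M 2 μ) (hG : MatrixMemLp G 2 μ)
    (h : ∀ᵐ x ∂μ, α * frobNorm (G x) ^ 2 ≤ (frobInner (A x * G x) (G x)).re) :
    α / 2 * ∫ x, frobNorm (G x) ^ 2 ∂μ
        - 1 / (2 * α) * ((matrixNorm A ∞ μ).toReal ^ 2 * ∫ x, frobNorm (M x) ^ 2 ∂μ)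
      ≤ (∫ x, frobInner (A x * (M x + G x)) (G x) ∂μ).re := by
  have hi := integrable_frobInner (hA.mul (hM.add hG)) hG
  have hGi := hG.memLp_frobNorm.integrable_sq
  have hMi := hM.memLp_frobNorm.integrable_sq
  have hAb : ∀ᵐ x ∂μ, frobNorm (A x) ≤ (matrixNorm A ∞ μ).toReal := by
    have h1 := hA.memLp_frobNorm
    filter_upwards [ae_le_eLpNormEssSup (f := fun x => frobNorm (A x)) (μ := μ)] with x hx
    have h2 : ‖frobNorm (A x)‖ₑ ≤ matrixNorm A ∞ μ := by
      rwa [matrixNorm, eLpNorm_exponent_top]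
    have h3 := ENNReal.toReal_mono h1.eLpNorm_ne_top h2
    rwa [toReal_enorm, Real.norm_of_nonneg (frobNorm_nonneg _)] at h3
  have hre : (∫ x, frobInner (A x * (M x + G x)) (G x) ∂μ).re
      = ∫ x, (frobInner (A x * (M x + G x)) (G x)).re ∂μ := (integral_re hi).symm
  rw [hre, ← integral_const_mul, ← integral_const_mul, ← integral_const_mul,
    ← integral_sub (hGi.const_mul _) ((hMi.const_mul _).const_mul _)]
  refine integral_mono_ae ((hGi.const_mul _).sub ((hMi.const_mul _).const_mul _)) hi.re ?_
  filter_upwards [h, hAb] with x hx hxA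
  refine le_trans ?_ (le_re_frobInner_add hα (M x) (G x) hx)
  have := frobNorm_nonneg (A x)
  gcongr

end Energy

/-! ### The unit cell -/

section Cell

theorem isCompact_unitCell : IsCompact unitCell := by
  have h : unitCell = (EuclideanSpace.equiv (Fin 3) ℝ).toHomeomorph ⁻¹'
      (Set.univ.pi fun _ => Set.Icc (0 : ℝ) 1) := by
    ext x
    simp only [unitCell, Set.mem_ofPred_eq, Set.mem_preimage, Set.mem_univ_pi]
    rfl
  rw [h, Homeomorph.isCompact_preimage]
  exact isCompact_univ_pi fun _ => isCompact_Icc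

theorem convex_unitCell : Convex ℝ unitCell := by
  have h : unitCell = ⋂ i : Fin 3, (EuclideanSpace.proj (𝕜 := ℝ) i : E3 →L[ℝ] ℝ) ⁻¹'
      (Set.Icc (0 : ℝ) 1) := by
    ext x
    simp [unitCell]
  rw [h]
  exact convex_iInter fun i =>
    (convex_Icc 0 1).linear_preimage (EuclideanSpace.proj (𝕜 := ℝ) i : E3 →L[ℝ] ℝ).toLinearMap

theorem measurableSet_unitCell : MeasurableSet unitCell := isCompact_unitCell.measurableSet

instance : IsFiniteMeasure cellMeasure :=
  ⟨by rw [cellMeasure, Measure.restrict_apply_univ]; exact isCompact_unitCell.measure_lt_top⟩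

/-- The boundary of a convex set is null. Only at interior points is `fderiv ℝ q` controlled by the
Lipschitz bound, since nothing is assumed on `q` outside the cell. -/
theorem ae_cellMeasure_mem_interior : ∀ᵐ x ∂cellMeasure, x ∈ interior unitCell := by
  have h0 : ∀ᵐ x ∂(volume : Measure E3), x ∉ frontier unitCell :=
    measure_eq_zero_iff_ae_notMem.1 (convex_unitCell.addHaar_frontier volume)
  filter_upwards [ae_restrict_of_ae h0, ae_restrict_mem measurableSet_unitCell] with x hx hxc
  by_contra hi
  exact hx ⟨subset_closure hxc, hi⟩

end Cell

/-! ### Bilipschitz bound from volume expansion -/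

section Expansion

/-- An injective map whose Jacobian is bounded below does not shrink volumes much. -/
theorem ofReal_mul_volume_le_volume_image {f : E3 → E3} (hf : Function.Injective f)
    {f' : E3 → E3 →L[ℝ] E3} {m : ℝ}
    (h : ∀ᵐ x ∂(volume : Measure E3), HasFDerivAt f (f' x) x ∧ m ≤ (f' x).det)
    {A : Set E3} (hA : MeasurableSet A) :
    ENNReal.ofReal m * volume A ≤ volume (f '' A) := by
  -- The exceptional set is removed from the domain only; for a lower bound its image can simply be
  -- dropped.
  obtain ⟨N, hN, hNm, hN0⟩ := exists_measurable_superset_of_null (ae_iff.1 h)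
  have hgood : ∀ x ∉ N, HasFDerivAt f (f' x) x ∧ m ≤ (f' x).det := fun x hx => by
    by_contra hc
    exact hx (hN hc)
  have hmeas : MeasurableSet (A \ N) := hA.diff hNm
  calc ENNReal.ofReal m * volume A = ENNReal.ofReal m * volume (A \ N) := by
        rw [measure_sdiff_null hN0]
    _ = ∫⁻ _ in A \ N, ENNReal.ofReal m := by rw [setLIntegral_const]
    _ ≤ ∫⁻ x in A \ N, ENNReal.ofReal |(f' x).det| :=
        setLIntegral_mono' hmeas fun x hx =>
          ENNReal.ofReal_le_ofReal ((hgood x hx.2).2.trans (le_abs_self _))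
    _ = volume (f '' (A \ N)) :=
        lintegral_abs_det_fderiv_eq_addHaar_image volume hmeas
          (fun x hx => (hgood x hx.2).1.hasFDerivWithinAt) hf.injOn
    _ ≤ volume (f '' A) := measure_mono (Set.image_mono Set.sdiff_subset)

/-- A Lipschitz injection of space which maps a compact convex set onto itself and does not shrink
volumes much is bilipschitz on that set: the preimage of a ball around a short segment contains
a chain of disjoint balls along the preimage of the segment. -/
theorem dist_le_of_volume_le {f : E3 → E3} {K m : ℝ} (hK : 0 < K) (hm : 0 < m)
    (hlip : ∀ x y, dist (f x) (f y) ≤ K * dist x y) (hinj : Function.Injective f)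
    (hvol : ∀ A : Set E3, MeasurableSet A → ENNReal.ofReal m * volume A ≤ volume (f '' A))
    {Y : Set E3} (hYc : IsCompact Y) (hYconv : Convex ℝ Y) (hYm : Set.MapsTo f Y Y)
    (hYs : Set.SurjOn f Y Y) {a b : E3} (ha : a ∈ Y) (hb : b ∈ Y) :
    dist a b ≤ 16 * K ^ 2 / m * dist (f a) (f b) := by
  rcases eq_or_ne a b with rfl | hab
  · simp
  have hcont : Continuous f :=
    (LipschitzWith.of_dist_le_mul (K := K.toNNReal) fun x y => by
      rw [Real.coe_toNNReal _ hK.le]; exact hlip x y).continuous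
  set d := dist (f a) (f b) with hd
  have hd0 : 0 < d := dist_pos.2 (hinj.ne hab)
  -- With this radius, `f` maps each ball of radius `ρ` into a ball of radius `d`.
  set ρ := d / K with hρ
  have hρ0 : 0 < ρ := div_pos hd0 hK
  have hchain : ∀ t ∈ Set.Icc (0 : ℝ) (dist b a), ∃ x ∈ Y, dist x a = t ∧
      dist (f x) (f a) ≤ d := by
    have : CompactSpace Y := isCompact_iff_compactSpace.1 hYc
    have hg : Continuous (fun x : Y => f x) := hcont.comp continuous_subtype_val
    -- On compact `Y` the injection `f` is a closed map, so the preimage of the segment is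
    -- connected. It joins `a` to `b`, so the distance to `a` takes every intermediate value on it.
    have hpre : IsPreconnected ((fun x : Y => f x) ⁻¹' segment ℝ (f a) (f b)) := by
      refine (convex_segment _ _).isPreconnected.preimage_of_isClosedMap
        (hinj.comp Subtype.val_injective) hg.isClosedMap fun z hz => ?_
      obtain ⟨x, hx, rfl⟩ := hYs (hYconv.segment_subset (hYm ha) (hYm hb) hz)
      exact ⟨⟨x, hx⟩, rfl⟩
    intro t ht
    have hiv := hpre.intermediate_value (a := ⟨a, ha⟩) (b := ⟨b, hb⟩)
      (left_mem_segment ℝ _ _) (right_mem_segment ℝ _ _)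
      (f := fun x : Y => dist (x : E3) a) (by fun_prop)
    obtain ⟨x, hx, hxt⟩ := hiv (by simpa using ht)
    refine ⟨x, x.2, hxt, ?_⟩
    have hx' : f x ∈ segment ℝ (f a) (f b) := hx
    have := (convex_closedBall (f a) d).segment_subset
      (Metric.mem_closedBall_self hd0.le) (by rw [Metric.mem_closedBall, dist_comm]) hx'
    exact this
  -- The distances `2ρn` with `0 ≤ n < N` stay within `dist b a`. Counting `n = 0` as well gives `N
  -- * 2ρ ≥ dist b a`, which is needed at the end.
  set N := ⌊dist b a / (2 * ρ)⌋₊ + 1 with hN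
  have hNle : ∀ n < N, 2 * ρ * n ∈ Set.Icc (0 : ℝ) (dist b a) := fun n hn => by
    refine ⟨by positivity, ?_⟩
    have h1 : (n : ℝ) ≤ dist b a / (2 * ρ) :=
      (Nat.cast_le.2 (Nat.lt_succ_iff.1 hn)).trans (Nat.floor_le (by positivity))
    rw [le_div_iff₀ (by positivity)] at h1
    linarith
  choose x _ hxd hxf using fun n : Fin N => hchain _ (hNle n n.2)
  have hdisj : Pairwise (Function.onFun Disjoint fun n => Metric.ball (x n) ρ) := by
    intro i j hij
    apply Metric.ball_disjoint_ball
    have h1 : |dist (x i) a - dist (x j) a| ≤ dist (x i) (x j) := abs_dist_sub_le _ _ _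
    rw [hxd, hxd, ← mul_sub, abs_mul, abs_of_pos (by positivity : 0 < 2 * ρ)] at h1
    have h2 : (1 : ℝ) ≤ |((i : ℕ) : ℝ) - ((j : ℕ) : ℝ)| := by
      have h3 : ((i : ℕ) : ℤ) - ((j : ℕ) : ℤ) ≠ 0 := by
        intro h; exact hij (Fin.ext (by omega))
      exact_mod_cast Int.one_le_abs h3
    nlinarith
  -- The centres map to within `d` of `f a`, being on the segment, and the balls add less than
  -- another `d`. However long the chain is, its image lies in a fixed ball, which bounds `N`.
  have hsub : f '' (⋃ n, Metric.ball (x n) ρ) ⊆ Metric.ball (f a) (2 * d) := by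
    rintro _ ⟨z, hz, rfl⟩
    obtain ⟨n, hn⟩ := Set.mem_iUnion.1 hz
    rw [Metric.mem_ball] at hn ⊢
    have h1 : K * dist z (x n) < d := by
      rw [hρ, lt_div_iff₀ hK] at hn
      linarith
    linarith [dist_triangle (f z) (f (x n)) (f a), hlip z (x n), hxf n]
  have hmain : ENNReal.ofReal m * (N * (ENNReal.ofReal (ρ ^ 3) * volume (Metric.ball (0 : E3) 1)))
      ≤ ENNReal.ofReal ((2 * d) ^ 3) * volume (Metric.ball (0 : E3) 1) := by
    have h1 := (hvol _ (MeasurableSet.iUnion fun n => Metric.isOpen_ball.measurableSet)).trans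
      (measure_mono hsub)
    rw [measure_iUnion hdisj fun n => Metric.isOpen_ball.measurableSet, tsum_fintype] at h1
    simp only [Measure.addHaar_ball volume _ hρ0.le] at h1
    rw [Measure.addHaar_ball volume _ (by positivity : 0 ≤ 2 * d)] at h1
    simpa using h1
  have hreal : m * (N * ρ ^ 3) ≤ (2 * d) ^ 3 := by
    have hv0 : volume (Metric.ball (0 : E3) 1) ≠ 0 := (Metric.measure_ball_pos _ _ one_pos).ne'
    have hvt : volume (Metric.ball (0 : E3) 1) ≠ ∞ := measure_ball_lt_top.ne
    rw [← mul_assoc, ← mul_assoc, mul_assoc (ENNReal.ofReal m),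
      ENNReal.mul_le_mul_iff_left hv0 hvt] at hmain
    rw [← ENNReal.ofReal_natCast, ← ENNReal.ofReal_mul (by positivity),
      ← ENNReal.ofReal_mul hm.le] at hmain
    exact (ENNReal.ofReal_le_ofReal_iff (by positivity)).1 hmain
  have hNge : dist b a ≤ N * (2 * ρ) := by
    have := (Nat.lt_floor_add_one (dist b a / (2 * ρ))).le
    rw [div_le_iff₀ (by positivity)] at this
    exact_mod_cast this
  have hdK : d = ρ * K := by rw [hρ]; field_simp
  rw [dist_comm a b, div_mul_eq_mul_div, le_div_iff₀ hm]
  have h3 : m * N ≤ 8 * K ^ 3 := by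
    have : m * N * ρ ^ 3 ≤ 8 * K ^ 3 * ρ ^ 3 := by
      calc m * N * ρ ^ 3 = m * (N * ρ ^ 3) := by ring
        _ ≤ (2 * d) ^ 3 := hreal
        _ = 8 * K ^ 3 * ρ ^ 3 := by rw [hdK]; ring
    exact le_of_mul_le_mul_right this (by positivity)
  calc dist b a * m ≤ N * (2 * ρ) * m := by gcongr
    _ = (m * N) * (2 * ρ) := by ring
    _ ≤ 8 * K ^ 3 * (2 * ρ) := by gcongr
    _ = 16 * K ^ 2 * d := by rw [hdK]; ring

end Expansion

/-! ### Lipschitz bound for the inverse deformation -/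

section Deformation

variable {S : Set E3} {τ : Fin 2 → E3 → E3} {δ : ℝ} {L : ℝ≥0} {q : E3 → E3}

/-- Extension by zero of a Lipschitz field vanishing on the boundary of the cell. -/
theorem lipschitzWith_indicator_unitCell (hl : LipschitzOnWith L q unitCell)
    (hb : ∀ x ∈ frontier unitCell, q x = 0) : LipschitzWith L (unitCell.indicator q) := by
  have hfr : frontier unitCell ⊆ unitCell :=
    isCompact_unitCell.isClosed.frontier_subset
  have hmix : ∀ x ∈ unitCell, ∀ y ∉ unitCell, dist (q x) 0 ≤ L * dist x y := by
    intro x hx y hy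
    -- The segment leaves the cell through a boundary point, where `q` vanishes and which is no
    -- farther from `x` than `y` is.
    obtain ⟨z, hz, hzf⟩ : ∃ z ∈ segment ℝ x y, z ∈ frontier unitCell := by
      by_contra! hno
      have hxi : x ∈ interior unitCell := by
        by_contra hxi
        exact hno x (left_mem_segment ℝ x y) ⟨subset_closure hx, hxi⟩
      obtain ⟨z, -, hz1, hz2⟩ := (convex_segment x y).isPreconnected _ _ isOpen_interior
        isCompact_unitCell.isClosed.isOpen_compl (fun z hz => by
          by_cases hzc : z ∈ unitCell
          · refine Or.inl ?_
            by_contra hzi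
            exact hno z hz ⟨subset_closure hzc, hzi⟩
          · exact Or.inr hzc)
        ⟨x, left_mem_segment ℝ x y, hxi⟩ ⟨y, right_mem_segment ℝ x y, hy⟩
      exact hz2 (interior_subset hz1)
    have h1 := hl.dist_le_mul x hx z (hfr hzf)
    rw [hb z hzf] at h1
    have h2 : dist z x ≤ dist x y := (convex_closedBall x (dist x y)).segment_subset
      (Metric.mem_closedBall_self dist_nonneg) (by rw [Metric.mem_closedBall, dist_comm]) hz
    rw [dist_comm] at h2
    exact h1.trans (mul_le_mul_of_nonneg_left h2 L.2)
  refine LipschitzWith.of_dist_le_mul fun x y => ?_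
  by_cases hx : x ∈ unitCell <;> by_cases hy : y ∈ unitCell
  · rw [Set.indicator_of_mem hx, Set.indicator_of_mem hy]
    exact hl.dist_le_mul x hx y hy
  · rw [Set.indicator_of_mem hx, Set.indicator_of_notMem hy]
    exact hmix x hx y hy
  · rw [Set.indicator_of_notMem hx, Set.indicator_of_mem hy, dist_comm, dist_comm x y]
    exact hmix y hy x hx
  · rw [Set.indicator_of_notMem hx, Set.indicator_of_notMem hy, dist_self]
    positivity

theorem det_id_add_fderiv (q : E3 → E3) (x : E3) :
    (ContinuousLinearMap.id ℝ E3 + fderiv ℝ q x).det = defDet q x := by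
  rw [ContinuousLinearMap.det, ← LinearMap.det_toMatrix (EuclideanSpace.basisFun (Fin 3) ℝ).toBasis,
    defDet]
  congr 1
  ext i j
  simp [LinearMap.toMatrix_apply, defGrad]

theorem dist_deform_le (hl : LipschitzOnWith L q unitCell) {x y : E3} (hx : x ∈ unitCell)
    (hy : y ∈ unitCell) : dist (deform q x) (deform q y) ≤ (1 + L) * dist x y := by
  have := hl.dist_le_mul x hx y hy
  calc dist (deform q x) (deform q y) ≤ dist x y + dist (q x) (q y) := dist_add_add_le _ _ _ _
    _ ≤ _ := by linarith

/-- The inverse of an admissible deformation is Lipschitz continuous, with a constant depending only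
on the lower bound of the Jacobian and the Lipschitz constant. -/
theorem IsDeformation.dist_le (hδ : 0 < δ) (hq : IsDeformation S τ δ L q) {x y : E3}
    (hx : x ∈ unitCell) (hy : y ∈ unitCell) :
    dist x y ≤ 16 * (1 + L) ^ 2 / min δ 1 * dist (deform q x) (deform q y) := by
  classical
  -- The balls of the volume count may stick out of the cell, so the map has to be a Lipschitz
  -- injection of the whole space. Continued by the identity it is one, because the cell is mapped
  -- to itself.
  set f : E3 → E3 := deform (unitCell.indicator q) with hf
  have hin : ∀ x ∈ unitCell, f x = deform q x := fun x hx => by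
    simp [hf, deform, Set.indicator_of_mem hx]
  have hout : ∀ x ∉ unitCell, f x = x := fun x hx => by
    simp [hf, deform, Set.indicator_of_notMem hx]
  have hlq := lipschitzWith_indicator_unitCell hq.lipschitz hq.boundary
  have hlip : ∀ x y, dist (f x) (f y) ≤ (1 + L) * dist x y := fun x y => by
    have := hlq.dist_le_mul x y
    calc dist (f x) (f y) ≤ dist x y + dist (unitCell.indicator q x) (unitCell.indicator q y) :=
          dist_add_add_le _ _ _ _
      _ ≤ _ := by linarith
  have hmaps : Set.MapsTo f unitCell unitCell := fun x hx => by
    rw [hin x hx]; exact hq.bijOn.mapsTo hx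
  have hsurj : Set.SurjOn f unitCell unitCell :=
    hq.bijOn.surjOn.congr fun x hx => (hin x hx).symm
  have hinj : Function.Injective f := fun x y hxy => by
    by_cases hx : x ∈ unitCell <;> by_cases hy : y ∈ unitCell
    · rw [hin x hx, hin y hy] at hxy
      exact hq.bijOn.injOn hx hy hxy
    · exact absurd (hxy ▸ hmaps hx) (by rwa [hout y hy])
    · exact absurd (hxy ▸ hmaps hy : f x ∈ unitCell) (by rwa [hout x hx])
    · rwa [hout x hx, hout y hy] at hxy
  -- Rademacher's theorem inside the cell; outside, the Jacobian is `1`, whence the bound `min δ 1`.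
  have hder : ∀ᵐ x ∂(volume : Measure E3),
      HasFDerivAt f (if x ∈ unitCell then ContinuousLinearMap.id ℝ E3 + fderiv ℝ q x
        else ContinuousLinearMap.id ℝ E3) x ∧
      min δ 1 ≤ (if x ∈ unitCell then ContinuousLinearMap.id ℝ E3 + fderiv ℝ q x
        else ContinuousLinearMap.id ℝ E3).det := by
    have h1 := (ae_restrict_iff' measurableSet_unitCell).1 ae_cellMeasure_mem_interior
    have h2 := (ae_restrict_iff' measurableSet_unitCell).1 hq.le_det
    filter_upwards [h1, h2, hq.lipschitz.ae_differentiableWithinAt_of_mem (μ := volume)]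
      with x hxi hxd hxq
    by_cases hx : x ∈ unitCell
    · have hnhds := mem_interior_iff_mem_nhds.1 (hxi hx)
      rw [if_pos hx, det_id_add_fderiv]
      refine ⟨?_, (min_le_left _ _).trans (hxd hx)⟩
      refine ((hasFDerivAt_id x).add
        ((hxq hx).differentiableAt hnhds).hasFDerivAt).congr_of_eventuallyEq ?_
      filter_upwards [hnhds] with z hz using hin z hz
    · rw [if_neg hx]
      refine ⟨(hasFDerivAt_id x).congr_of_eventuallyEq ?_, ?_⟩
      · filter_upwards [isCompact_unitCell.isClosed.isOpen_compl.mem_nhds hx] with z hz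
          using hout z hz
      · simp [ContinuousLinearMap.det]
  have := dist_le_of_volume_le (by positivity : (0 : ℝ) < 1 + L) (lt_min hδ one_pos) hlip hinj
    (fun A hA => ofReal_mul_volume_le_volume_image hinj hder hA) isCompact_unitCell
    convex_unitCell hmaps hsurj hx hy
  rwa [hin x hx, hin y hy] at this

end Deformation

/-! ### Pulled back tensors -/

section PulledBackTensor

variable {l m n : Type*} [Fintype l] [Fintype m] [Fintype n]

/-- Serves bulk and surface alike: `T` is `F⁻ᵀ` with `M = Fᵀ` and `κ = J`, or `T` is `D` with `M =
Bᵀ` and the area factor. -/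
theorem frobInner_pullback (e : Matrix l l ℂ) (T : Matrix l m ℝ) (M G H : Matrix m n ℂ) (κ : ℂ) :
    frobInner (e * (toComplex T * M + toComplex T * G)) (toComplex T * H) * κ
      = frobInner ((κ • ((toComplex T)ᵀ * e * toComplex T)) * (M + G)) H := by
  rw [frobInner_toComplex_mul_right, ← Matrix.mul_add, Matrix.smul_mul, frobInner_smul_left,
    mul_comm]
  simp only [Matrix.mul_assoc]

theorem dotProduct_re_mulVec_pullback (e : Matrix l l ℂ) (T : Matrix l m ℝ) (κ : ℝ) (ξ : m → ℝ) :
    ξ ⬝ᵥ (((κ : ℂ) • ((toComplex T)ᵀ * e * toComplex T)).map Complex.re *ᵥ ξ)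
      = κ * ((T *ᵥ ξ) ⬝ᵥ (e.map Complex.re *ᵥ (T *ᵥ ξ))) := by
  have h : ((κ : ℂ) • ((toComplex T)ᵀ * e * toComplex T)).map Complex.re
      = κ • (Tᵀ * e.map Complex.re * T) := by
    ext i j
    simp only [Matrix.map_apply, Matrix.smul_apply, smul_eq_mul, Complex.re_ofReal_mul,
      Matrix.mul_apply, toComplex, Matrix.transpose_apply, Complex.re_sum, Complex.re_mul_ofReal]
  rw [h, Matrix.smul_mulVec, dotProduct_smul, smul_eq_mul, ← Matrix.mulVec_mulVec,
    ← Matrix.mulVec_mulVec, Matrix.dotProduct_mulVec, Matrix.vecMul_transpose]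

/-- Since `|a|² = Ba · Ta`, Cauchy–Schwarz turns an upper bound for `B` into a lower bound for its
dual `T`. No bound on an inverse matrix is needed. -/
theorem dotProduct_self_le_of_transpose_mul_eq_one [DecidableEq m] {B T : Matrix l m ℝ} {K : ℝ}
    (hBT : Bᵀ * T = 1) (hB : ∀ a : m → ℝ, (B *ᵥ a) ⬝ᵥ (B *ᵥ a) ≤ K * (a ⬝ᵥ a)) (a : m → ℝ) :
    a ⬝ᵥ a ≤ K * ((T *ᵥ a) ⬝ᵥ (T *ᵥ a)) := by
  have h1 : a ⬝ᵥ a = (B *ᵥ a) ⬝ᵥ (T *ᵥ a) := by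
    have h : Bᵀ *ᵥ (T *ᵥ a) = a := by rw [Matrix.mulVec_mulVec, hBT, Matrix.one_mulVec]
    calc a ⬝ᵥ a = a ⬝ᵥ (Bᵀ *ᵥ (T *ᵥ a)) := by rw [h]
      _ = (B *ᵥ a) ⬝ᵥ (T *ᵥ a) := by rw [Matrix.dotProduct_mulVec, Matrix.vecMul_transpose]
  have h2 : ((B *ᵥ a) ⬝ᵥ (T *ᵥ a)) ^ 2
      ≤ ((B *ᵥ a) ⬝ᵥ (B *ᵥ a)) * ((T *ᵥ a) ⬝ᵥ (T *ᵥ a)) := by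
    simpa only [dotProduct, sq] using Finset.sum_mul_sq_le_sq_mul_sq Finset.univ (B *ᵥ a) (T *ᵥ a)
  have hTn : 0 ≤ (T *ᵥ a) ⬝ᵥ (T *ᵥ a) := Finset.sum_nonneg fun i _ => mul_self_nonneg _
  have han : 0 ≤ a ⬝ᵥ a := Finset.sum_nonneg fun i _ => mul_self_nonneg _
  rcases han.eq_or_lt with h0 | h0
  · have : a = 0 := dotProduct_self_eq_zero.1 h0.symm
    simp [this]
  · rw [← h1] at h2
    have h3 : (a ⬝ᵥ a) * (a ⬝ᵥ a) ≤ (a ⬝ᵥ a) * (K * ((T *ᵥ a) ⬝ᵥ (T *ᵥ a))) := by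
      nlinarith [mul_le_mul_of_nonneg_right (hB a) hTn]
    exact le_of_mul_le_mul_left h3 h0

/-- Coercivity of a pulled back tensor. -/
theorem coercive_pullback [DecidableEq m] {e : Matrix l l ℂ} {B T : Matrix l m ℝ} {K c κ₀ κ : ℝ}
    (hK : 0 < K) (hc : 0 < c) (hκ₀ : 0 ≤ κ₀) (hκ : κ₀ ≤ κ) (he : e.IsSymm) (hBT : Bᵀ * T = 1)
    (hB : ∀ a : m → ℝ, (B *ᵥ a) ⬝ᵥ (B *ᵥ a) ≤ K * (a ⬝ᵥ a))
    (hell : ∀ a : m → ℝ,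
      c * ((T *ᵥ a) ⬝ᵥ (T *ᵥ a)) ≤ (T *ᵥ a) ⬝ᵥ (e.map Complex.re *ᵥ (T *ᵥ a)))
    (G : Matrix m n ℂ) :
    c * κ₀ / K * frobNorm G ^ 2
      ≤ (frobInner (((κ : ℂ) • ((toComplex T)ᵀ * e * toComplex T)) * G) G).re := by
  refine le_re_frobInner_of_isSymm ?_ (fun ξ => ?_) G
  · rw [Matrix.IsSymm, Matrix.transpose_smul, Matrix.transpose_mul, Matrix.transpose_mul,
      Matrix.transpose_transpose, he.eq, Matrix.mul_assoc]
  · rw [dotProduct_re_mulVec_pullback]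
    have h1 := dotProduct_self_le_of_transpose_mul_eq_one hBT hB ξ
    have hTn : 0 ≤ (T *ᵥ ξ) ⬝ᵥ (T *ᵥ ξ) := Finset.sum_nonneg fun i _ => mul_self_nonneg _
    calc c * κ₀ / K * (ξ ⬝ᵥ ξ) ≤ c * κ₀ / K * (K * ((T *ᵥ ξ) ⬝ᵥ (T *ᵥ ξ))) := by gcongr
      _ = κ₀ * (c * ((T *ᵥ ξ) ⬝ᵥ (T *ᵥ ξ))) := by field_simp
      _ ≤ κ * (c * ((T *ᵥ ξ) ⬝ᵥ (T *ᵥ ξ))) := by gcongr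
      _ ≤ _ := mul_le_mul_of_nonneg_left (hell ξ) (hκ₀.trans hκ)

end PulledBackTensor

/-! ### The Gram matrix of the deformed frame -/

section SurfaceMatrix

variable {B : Matrix (Fin 3) (Fin 2) ℝ} {r : ℝ}

theorem sq_le_det_transpose_mul_self (hr : 0 ≤ r)
    (hB : ∀ a : Fin 2 → ℝ, r * (a ⬝ᵥ a) ≤ (B *ᵥ a) ⬝ᵥ (B *ᵥ a)) :
    r ^ 2 ≤ (Bᵀ * B).det := by
  have hG : ∀ a : Fin 2 → ℝ, (B *ᵥ a) ⬝ᵥ (B *ᵥ a) = a ⬝ᵥ ((Bᵀ * B) *ᵥ a) := fun a => by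
    rw [← Matrix.mulVec_mulVec, Matrix.dotProduct_mulVec a, Matrix.vecMul_transpose]
  have hsymm : (Bᵀ * B) 1 0 = (Bᵀ * B) 0 1 := by
    simp only [Matrix.mul_apply, Matrix.transpose_apply]
    exact Finset.sum_congr rfl fun i _ => mul_comm _ _
  set G := Bᵀ * B with hGdef
  have key : ∀ s t : ℝ, r * (s ^ 2 + t ^ 2) ≤ G 0 0 * s ^ 2 + 2 * G 0 1 * s * t + G 1 1 * t ^ 2 := by
    intro s t
    have := hB ![s, t]
    rw [hG] at this
    simp [dotProduct, Matrix.mulVec, Fin.sum_univ_two, hsymm] at this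
    nlinarith
  rw [Matrix.det_fin_two, hsymm]
  have h0 := key 1 0
  have h1 := key 0 1
  have hp : 0 ≤ G 0 0 - r := by linarith
  have hq : 0 ≤ G 1 1 - r := by linarith
  -- The form of `BᵀB - r` is nonnegative, so its discriminant is not positive; expanding `det G`
  -- around `r` then leaves `r²` plus nonnegative terms.
  have hdisc : G 0 1 ^ 2 ≤ (G 0 0 - r) * (G 1 1 - r) := by
    have := discrim_le_zero (a := G 0 0 - r) (b := 2 * G 0 1) (c := G 1 1 - r) fun x => by
      have := key x 1
      nlinarith
    rw [discrim] at this
    nlinarith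
  nlinarith [mul_nonneg hr hp, mul_nonneg hr hq]

theorem transpose_mul_dualTangentMatrix (h : (Bᵀ * B).det ≠ 0) :
    Bᵀ * dualTangentMatrix B = 1 := by
  rw [dualTangentMatrix, ← Matrix.mul_assoc, Matrix.mul_nonsing_inv _ (isUnit_iff_ne_zero.2 h)]

end SurfaceMatrix

/-! ### Bounded matrix fields -/

section BoundedMatrixFields

variable {m n : Type*} [Fintype m] [Fintype n] {μ : Measure E3}

/-- A continuous function is bounded on the compact box of matrices with entries in `[-K, K]`.
Applied to determinants, adjugates and the area factor; the resulting bounds serve integrability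
only and do not enter `C`. -/
theorem memLp_top_continuous_comp_matrix {A : E3 → Matrix m n ℝ} {g : Matrix m n ℝ → ℝ}
    (hg : Continuous g) (hm : ∀ i j, AEStronglyMeasurable (fun x => A x i j) μ) {K : ℝ}
    (hb : ∀ᵐ x ∂μ, ∀ i j, |A x i j| ≤ K) : MemLp (fun x => g (A x)) ∞ μ := by
  have hA : AEStronglyMeasurable (fun x i j => A x i j) μ :=
    (aemeasurable_pi_lambda _ fun i => aemeasurable_pi_lambda _ fun j =>
      (hm i j).aemeasurable).aestronglyMeasurable
  have hcpt : IsCompact (Set.univ.pi fun _ : m => Set.univ.pi fun _ : n => Set.Icc (-K) K) :=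
    isCompact_univ_pi fun _ => isCompact_univ_pi fun _ => isCompact_Icc
  obtain ⟨C, hC⟩ := hcpt.exists_bound_of_continuousOn (f := g) hg.continuousOn
  refine memLp_top_of_bound (hg.comp_aestronglyMeasurable hA) C ?_
  filter_upwards [hb] with x hx
  exact hC _ fun i _ j _ => abs_le.1 (hx i j)

theorem memLp_top_inv {f : E3 → ℝ} (hf : AEStronglyMeasurable f μ) {r : ℝ} (hr : 0 < r)
    (h : ∀ᵐ x ∂μ, r ≤ f x) : MemLp (fun x => (f x)⁻¹) ∞ μ := by
  refine memLp_top_of_bound hf.aemeasurable.inv.aestronglyMeasurable r⁻¹ ?_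
  filter_upwards [h] with x hx
  rw [norm_inv, Real.norm_of_nonneg (hr.le.trans hx)]
  exact inv_anti₀ hr hx

omit [Fintype m] in
theorem MatrixMemLp.pullback {l : Type*} [Fintype l] {e : E3 → Matrix l l ℂ}
    {T : E3 → Matrix l m ℝ} {κ : E3 → ℝ} (he : MatrixMemLp e ∞ μ)
    (hT : ∀ i j, MemLp (fun x => T x i j) ∞ μ) (hκ : MemLp κ ∞ μ) :
    MatrixMemLp (fun x => (κ x : ℂ) • ((toComplex (T x))ᵀ * e x * toComplex (T x))) ∞ μ := by
  have hT' : MatrixMemLp (fun x => toComplex (T x)) ∞ μ := fun i j => (hT i j).ofReal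
  have hTt : MatrixMemLp (fun x => (toComplex (T x))ᵀ) ∞ μ := fun i j => hT' j i
  intro i j
  exact (((hTt.mul he).mul hT') i j).mul hκ.ofReal

end BoundedMatrixFields

/-! ### Pointwise bounds for the deformation gradient -/

section Fields

variable {S : Set E3} {τ : Fin 2 → E3 → E3} {δ : ℝ} {L : ℝ≥0} {q : E3 → E3}

theorem dotProduct_self_eq_norm_sq (v : E3) : (v : Fin 3 → ℝ) ⬝ᵥ v = ‖v‖ ^ 2 := by
  rw [EuclideanSpace.real_norm_sq_eq]
  exact Finset.sum_congr rfl fun i _ => (sq _).symm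

theorem defGrad_mulVec (q : E3 → E3) (x : E3) (a : Fin 3 → ℝ) :
    defGrad q x *ᵥ a = (WithLp.toLp 2 a + fderiv ℝ q x (WithLp.toLp 2 a) : E3) := by
  have ha : (WithLp.toLp 2 a : E3) = ∑ j, a j • EuclideanSpace.single j (1 : ℝ) := by
    ext i
    simp [Finset.sum_apply, Pi.single_apply]
  ext i
  have h2 : fderiv ℝ q x (WithLp.toLp 2 a)
      = ∑ j, a j • fderiv ℝ q x (EuclideanSpace.single j 1) := by
    rw [ha, map_sum]
    simp
  rw [h2]
  simp [Matrix.mulVec, dotProduct, defGrad, mul_add, Finset.sum_add_distrib, mul_comm _ (a _)]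

theorem tangentMatrix_mulVec (p : E3) (a : Fin 2 → ℝ) :
    tangentMatrix S τ q p *ᵥ a
      = (∑ k, a k • τ k p + fderivWithin ℝ q S p (∑ k, a k • τ k p) : E3) := by
  ext i
  simp [Matrix.mulVec, dotProduct, tangentMatrix, map_add]
  ring

theorem norm_fderiv_le_of_mem_interior (hl : LipschitzOnWith L q unitCell) {x : E3}
    (hx : x ∈ interior unitCell) : ‖fderiv ℝ q x‖ ≤ L :=
  norm_fderiv_le_of_lipschitzOn ℝ (mem_interior_iff_mem_nhds.1 hx) hl

theorem defGrad_mulVec_dotProduct_le (hl : LipschitzOnWith L q unitCell) {x : E3}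
    (hx : x ∈ interior unitCell) (a : Fin 3 → ℝ) :
    (defGrad q x *ᵥ a) ⬝ᵥ (defGrad q x *ᵥ a) ≤ (1 + L) ^ 2 * (a ⬝ᵥ a) := by
  have h1 : a ⬝ᵥ a = ‖(WithLp.toLp 2 a : E3)‖ ^ 2 := dotProduct_self_eq_norm_sq (WithLp.toLp 2 a)
  rw [defGrad_mulVec, dotProduct_self_eq_norm_sq, h1, ← mul_pow]
  have h2 := (fderiv ℝ q x).le_of_opNorm_le (norm_fderiv_le_of_mem_interior hl hx)
    (WithLp.toLp 2 a)
  have h3 := norm_add_le (WithLp.toLp 2 a : E3) (fderiv ℝ q x (WithLp.toLp 2 a))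
  gcongr
  linarith

theorem abs_defGrad_le (hl : LipschitzOnWith L q unitCell) {x : E3}
    (hx : x ∈ interior unitCell) (i j : Fin 3) : |defGrad q x i j| ≤ 1 + L := by
  have h1 := defGrad_mulVec_dotProduct_le hl hx (Pi.single j 1)
  have h2 : (defGrad q x i j) ^ 2 ≤ (1 + L) ^ 2 := by
    simp only [Matrix.mulVec_single_one, dotProduct_single_one, Pi.single_eq_same, mul_one] at h1
    refine le_trans ?_ h1
    rw [sq]
    exact Finset.single_le_sum (f := fun i => (defGrad q x).col j i * (defGrad q x).col j i)
      (fun _ _ => mul_self_nonneg _) (Finset.mem_univ i)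
  exact abs_le_of_sq_le_sq h2 (by positivity)

theorem measurable_defGrad (q : E3 → E3) (i j : Fin 3) :
    Measurable fun x => defGrad q x i j := by
  have h : Measurable fun x => (fderiv ℝ q x) (EuclideanSpace.single j 1) :=
    measurable_fderiv_apply_const ℝ q _
  have h2 : Measurable fun v : E3 => v i :=
    (EuclideanSpace.proj (𝕜 := ℝ) i : E3 →L[ℝ] ℝ).continuous.measurable
  simp only [defGrad, Matrix.of_apply]
  exact measurable_const.add (h2.comp h)

theorem continuousOn_deform (hl : LipschitzOnWith L q unitCell) :
    ContinuousOn (deform q) unitCell :=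
  continuousOn_id.add hl.continuousOn

end Fields

/-! ### Bounds for tangential derivatives on the surface -/

section Surface

variable {S : Set E3} {τ : Fin 2 → E3 → E3} {δ : ℝ} {L : ℝ≥0} {q : E3 → E3}

theorem ae_surfaceMeasure_mem (hS : IsInclusion S) :
    ∀ᵐ p ∂surfaceMeasure S, p ∈ S ∧ p ∈ regularPart S := by
  refine Measure.ae_smul_measure ?_ _
  rw [ae_restrict_iff' hS.isCompact.measurableSet]
  filter_upwards [measure_eq_zero_iff_ae_notMem.1 hS.regular_ae] with p hp hpS
  refine ⟨hpS, ?_⟩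
  by_contra h
  exact hp ⟨hpS, h⟩

instance isFiniteMeasure_surfaceMeasure [h : Fact (IsInclusion S)] :
    IsFiniteMeasure (surfaceMeasure S) := by
  have : IsFiniteMeasure ((Measure.hausdorffMeasure 2 : Measure E3).restrict S) :=
    ⟨by rw [Measure.restrict_apply_univ]; exact h.out.finite_area.lt_top⟩
  exact Measure.smul_finite _ ENNReal.ofReal_ne_top

theorem IsSurfaceChart.mapsTo {U : Set E2} {X : E2 → E3} (h : IsSurfaceChart S U X) :
    Set.MapsTo X U S := by
  obtain ⟨W, -, hW⟩ := h.isOpen_image U subset_rfl h.isOpen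
  intro u hu
  have : X u ∈ X '' U := ⟨u, hu, rfl⟩
  rw [hW] at this
  exact this.1

/-- The derivative of an admissible deformation within the surface is bounded from above and below
on tangent vectors. -/
theorem IsDeformation.norm_tangent_bounds (hδ : 0 < δ) (hq : IsDeformation S τ δ L q)
    (hSc : S ⊆ unitCell) {U : Set E2} {X : E2 → E3} (hX : IsSurfaceChart S U X) {u : E2}
    (hu : u ∈ U) (v : E2) :
    ‖fderiv ℝ X u v‖ ≤ 16 * (1 + L) ^ 2 / min δ 1
        * ‖fderiv ℝ X u v + fderivWithin ℝ q S (X u) (fderiv ℝ X u v)‖ ∧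
      ‖fderiv ℝ X u v + fderivWithin ℝ q S (X u) (fderiv ℝ X u v)‖
        ≤ (1 + L) * ‖fderiv ℝ X u v‖ := by
  set M : ℝ := 16 * (1 + L) ^ 2 / min δ 1 with hM
  have hmin : 0 < min δ 1 := lt_min hδ one_pos
  have hL : (0 : ℝ) ≤ L := L.2
  have hUn : U ∈ 𝓝 u := hX.isOpen.mem_nhds hu
  have hXd : HasFDerivAt X (fderiv ℝ X u) u :=
    ((hX.contDiffOn.contDiffAt hUn).differentiableAt one_ne_zero).hasFDerivAt
  set w := fderiv ℝ X u v with hw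
  by_cases hd : DifferentiableWithinAt ℝ q S (X u)
  · have hqX : HasFDerivAt (q ∘ X) ((fderivWithin ℝ q S (X u)).comp (fderiv ℝ X u)) u :=
      (hd.hasFDerivWithinAt.comp u hXd.hasFDerivWithinAt hX.mapsTo).hasFDerivAt hUn
    have hline : HasDerivAt (fun t : ℝ => u + t • v) v 0 := by
      simpa using ((hasDerivAt_id (0 : ℝ)).smul_const v).const_add u
    have hu0 : u + (0 : ℝ) • v = u := by simp
    -- The two-sided Lipschitz bounds are applied to difference quotients along the curve `X (u + t
    -- v)`, which stays in the surface for small `t`, and passed to the limit.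
    have hg : HasDerivAt (fun t : ℝ => X (u + t • v)) w 0 := by
      have : HasFDerivAt X (fderiv ℝ X u) (u + (0 : ℝ) • v) := by rwa [hu0]
      exact this.comp_hasDerivAt 0 hline
    have hh : HasDerivAt (fun t : ℝ => deform q (X (u + t • v)))
        (w + fderivWithin ℝ q S (X u) w) 0 := by
      have : HasFDerivAt (q ∘ X) ((fderivWithin ℝ q S (X u)).comp (fderiv ℝ X u))
          (u + (0 : ℝ) • v) := by rwa [hu0]
      exact hg.add (this.comp_hasDerivAt (f := fun t : ℝ => u + t • v) 0 hline)
    have hnear : ∀ᶠ t : ℝ in 𝓝[≠] 0, X (u + t • v) ∈ unitCell := by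
      have h1 : ∀ᶠ t : ℝ in 𝓝 0, u + t • v ∈ U :=
        hline.continuousAt.eventually_mem (by rwa [hu0])
      exact (h1.filter_mono nhdsWithin_le_nhds).mono fun t ht => hSc (hX.mapsTo ht)
    have hXu : X u ∈ unitCell := hSc (hX.mapsTo hu)
    have hgl := hg.tendsto_slope_zero.norm
    have hhl := hh.tendsto_slope_zero.norm
    simp only [zero_add, hu0, norm_smul, ← dist_eq_norm] at hgl hhl
    constructor
    · refine le_of_tendsto_of_tendsto hgl (hhl.const_mul M) (hnear.mono fun t ht => ?_)
      have := hq.dist_le hδ ht hXu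
      calc ‖t⁻¹‖ * dist (X (u + t • v)) (X u)
          ≤ ‖t⁻¹‖ * (M * dist (deform q (X (u + t • v))) (deform q (X u))) := by gcongr
        _ = _ := by ring
    · refine le_of_tendsto_of_tendsto hhl (hgl.const_mul (1 + L : ℝ)) (hnear.mono fun t ht => ?_)
      have := dist_deform_le hq.lipschitz ht hXu
      calc ‖t⁻¹‖ * dist (deform q (X (u + t • v))) (deform q (X u))
          ≤ ‖t⁻¹‖ * ((1 + L) * dist (X (u + t • v)) (X u)) := by gcongr
        _ = _ := by ring
  -- Where `q` is not differentiable within `S`, `fderivWithin` is zero by convention. Both bounds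
  -- then hold because `M ≥ 1`, so no Rademacher theorem on the surface is needed.
  · rw [fderivWithin_zero_of_not_differentiableWithinAt hd]
    simp only [zero_apply, add_zero]
    have hM1 : 1 ≤ M := by
      rw [hM, le_div_iff₀ hmin]
      nlinarith [min_le_right δ 1]
    constructor <;> nlinarith [norm_nonneg w]

/-- The matrix of the deformed frame is a.e. bounded from above and below. -/
theorem IsDeformation.tangentMatrix_bounds (hS : IsInclusion S) (hτ : IsTangentFrame S τ)
    (hδ : 0 < δ) (hq : IsDeformation S τ δ L q) :
    ∀ᵐ p ∂surfaceMeasure S, ∀ a : Fin 2 → ℝ,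
      ((16 * (1 + L) ^ 2 / min δ 1) ^ 2)⁻¹ * (a ⬝ᵥ a)
          ≤ (tangentMatrix S τ q p *ᵥ a) ⬝ᵥ (tangentMatrix S τ q p *ᵥ a) ∧
        (tangentMatrix S τ q p *ᵥ a) ⬝ᵥ (tangentMatrix S τ q p *ᵥ a)
          ≤ (1 + L) ^ 2 * (a ⬝ᵥ a) := by
  filter_upwards [ae_surfaceMeasure_mem hS, hτ.orthonormal, hτ.tangent] with p hp ho ht a
  obtain ⟨U, X, hX, u, hu, rfl⟩ := hp.2
  choose v hv using ht U X hX u hu rfl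
  have hw : ∑ k, a k • τ k (X u) = fderiv ℝ X u (∑ k, a k • v k) := by
    simp [hv]
  have hn : a ⬝ᵥ a = ‖∑ k, a k • τ k (X u)‖ ^ 2 := by
    rw [← real_inner_self_eq_norm_sq, ho.inner_sum]
    simp [dotProduct]
  obtain ⟨h1, h2⟩ := hq.norm_tangent_bounds hδ hS.subset_unitCell hX hu (∑ k, a k • v k)
  rw [tangentMatrix_mulVec, dotProduct_self_eq_norm_sq, hn, hw]
  have hmin : 0 < min δ 1 := lt_min hδ one_pos
  have hM : (0 : ℝ) < 16 * (1 + L) ^ 2 / min δ 1 := by positivity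
  constructor
  · rw [inv_mul_le_iff₀ (by positivity), ← mul_pow]
    gcongr
  · rw [← mul_pow]
    gcongr

theorem IsDeformation.aestronglyMeasurable_tangentMatrix (hτ : IsTangentFrame S τ)
    (hq : IsDeformation S τ δ L q) (i : Fin 3) (k : Fin 2) :
    AEStronglyMeasurable (fun p => tangentMatrix S τ q p i k) (surfaceMeasure S) := by
  have hproj : Continuous fun v : E3 => v i :=
    (EuclideanSpace.proj (𝕜 := ℝ) i : E3 →L[ℝ] ℝ).continuous
  simp only [tangentMatrix, Matrix.of_apply]
  exact (hproj.measurable.comp (hτ.measurable k)).aestronglyMeasurable.add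
    (hproj.comp_aestronglyMeasurable (hq.tangential k).1)

end Surface

/-! ### Fourier series on the cell: zero weak gradient implies constant -/

section Periodic

noncomputable local instance : MeasureSpace UnitAddCircle := ⟨AddCircle.haarAddCircle⟩

local instance : Measure.IsAddHaarMeasure (volume : Measure UnitAddCircle) :=
  inferInstanceAs (Measure.IsAddHaarMeasure AddCircle.haarAddCircle)

local instance : IsProbabilityMeasure (volume : Measure UnitAddCircle) :=
  inferInstanceAs (IsProbabilityMeasure AddCircle.haarAddCircle)

/-- The exponential `exp (2πi n · x)`. -/
noncomputable def cellExp (n : Fin 3 → ℤ) (x : E3) : ℂ :=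
  Complex.exp (∑ i, (2 * Real.pi * Complex.I * n i) * (x i : ℂ))

theorem hasFDerivAt_cellExp (n : Fin 3 → ℤ) (x : E3) :
    HasFDerivAt (cellExp n) (cellExp n x • ∑ i, (2 * Real.pi * Complex.I * n i : ℂ) •
      Complex.ofRealCLM.comp (EuclideanSpace.proj (𝕜 := ℝ) i : E3 →L[ℝ] ℝ)) x := by
  refine HasFDerivAt.cexp (HasFDerivAt.fun_sum fun i _ => ?_)
  exact (Complex.ofRealCLM.comp
    (EuclideanSpace.proj (𝕜 := ℝ) i : E3 →L[ℝ] ℝ)).hasFDerivAt.const_mul _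

theorem sum_mul_ofReal_single (a : Fin 3 → ℂ) (j : Fin 3) :
    ∑ i, a i * (((EuclideanSpace.single j (1 : ℝ) : E3) i : ℝ) : ℂ) = a j := by
  rw [Finset.sum_eq_single j (fun i _ hi => by simp [hi]) (by simp)]
  simp

theorem partialDeriv_cellExp (n : Fin 3 → ℤ) (j : Fin 3) (x : E3) :
    partialDeriv j (cellExp n) x = (2 * Real.pi * Complex.I * n j) * cellExp n x := by
  rw [partialDeriv, (hasFDerivAt_cellExp n x).fderiv]
  rw [smul_apply, sum_apply, smul_eq_mul, mul_comm]
  congr 1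
  exact sum_mul_ofReal_single (fun i => 2 * Real.pi * Complex.I * n i) j

theorem isSmoothPeriodic_cellExp (n : Fin 3 → ℤ) : IsSmoothPeriodic (cellExp n) := by
  constructor
  · refine ContDiff.cexp (ContDiff.sum fun i _ => contDiff_const.mul ?_)
    exact (Complex.ofRealCLM.comp (EuclideanSpace.proj (𝕜 := ℝ) i : E3 →L[ℝ] ℝ)).contDiff
  · intro i x
    rw [cellExp, cellExp, Complex.exp_eq_exp_iff_exists_int]
    refine ⟨n i, ?_⟩
    simp only [PiLp.add_apply, Complex.ofReal_add, mul_add, Finset.sum_add_distrib]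
    rw [sum_mul_ofReal_single fun i => 2 * Real.pi * Complex.I * n i]
    ring

/-- The standard lift of the torus to the cell. -/
noncomputable def torusLift (t : UnitAddTorus (Fin 3)) : E3 :=
  (MeasurableEquiv.toLp 2 (Fin 3 → ℝ)) (UnitAddTorus.measurableEquivPiIoc (0 : Fin 3 → ℝ) t).1

theorem measurePreserving_torusLift :
    MeasurePreserving torusLift volume cellMeasure := by
  have hmeas : MeasurableSet {x : Fin 3 → ℝ | ∀ i, x i ∈ Set.Ioc ((0 : Fin 3 → ℝ) i)
      ((0 : Fin 3 → ℝ) i + 1)} := MeasurableSet.univ_pi' fun i => measurableSet_Ioc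
  have h1 := UnitAddTorus.measurePreserving_equivPiIoc (0 : Fin 3 → ℝ)
  have h2 := measurePreserving_subtype_coe (μa := (volume : Measure (Fin 3 → ℝ))) hmeas
  have hcell : {x : Fin 3 → ℝ | ∀ i, x i ∈ Set.Ioc ((0 : Fin 3 → ℝ) i)
      ((0 : Fin 3 → ℝ) i + 1)} =ᵐ[volume]
      -- The torus is cut open along half-open intervals; the closed cell differs by a null set of
      -- faces.
      (MeasurableEquiv.toLp 2 (Fin 3 → ℝ)) ⁻¹' unitCell := by
    have e1 : {x : Fin 3 → ℝ | ∀ i, x i ∈ Set.Ioc ((0 : Fin 3 → ℝ) i)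
        ((0 : Fin 3 → ℝ) i + 1)} = Set.univ.pi fun i => Set.Ioc ((0 : Fin 3 → ℝ) i) (1 : ℝ) := by
      ext x; simp
    have e2 : (MeasurableEquiv.toLp 2 (Fin 3 → ℝ)) ⁻¹' unitCell
        = Set.Icc (0 : Fin 3 → ℝ) (fun _ => 1) := by
      ext x
      simp only [unitCell, Set.mem_preimage, Set.mem_ofPred_eq, Set.mem_Icc, Pi.le_def,
        forall_and]
      rfl
    rw [e1, e2]
    exact Measure.univ_pi_Ioc_ae_eq_Icc (μ := fun _ : Fin 3 => (volume : Measure ℝ))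
      (f := 0) (g := fun _ => 1)
  have h3 : MeasurePreserving (MeasurableEquiv.toLp 2 (Fin 3 → ℝ))
      (volume.restrict ((MeasurableEquiv.toLp 2 (Fin 3 → ℝ)) ⁻¹' unitCell)) cellMeasure :=
    (PiLp.volume_preserving_toLp (Fin 3)).restrict_preimage measurableSet_unitCell
  rw [Measure.restrict_congr_set hcell] at h2
  exact h3.comp (h2.comp h1)

theorem mFourier_eq_cellExp (n : Fin 3 → ℤ) (t : UnitAddTorus (Fin 3)) :
    UnitAddTorus.mFourier n t = cellExp n (torusLift t) := by
  have ht : ∀ i, ((torusLift t i : ℝ) : UnitAddCircle) = t i := fun i =>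
    (AddCircle.equivIoc 1 (0 : ℝ)).symm_apply_apply (t i)
  rw [cellExp, Complex.exp_sum]
  change ∏ i, fourier (n i) (t i) = _
  refine Finset.prod_congr rfl fun i _ => ?_
  rw [← ht i, fourier_coe_apply]
  congr 1
  simp

/-- A periodic function whose weak gradient vanishes is constant. -/
theorem HasPeriodicWeakGradient.ae_eq_const {φ : E3 → ℂ} {g : E3 → Fin 3 → ℂ}
    (h : HasPeriodicWeakGradient φ g) (hg : ∀ j, ∀ᵐ x ∂cellMeasure, g x j = 0) :
    ∃ b : ℂ, ∀ᵐ x ∂cellMeasure, φ x = b := by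
  -- Integration by parts in a direction `j` with `n j ≠ 0`: differentiating the exponential only
  -- multiplies it by `2πi n j`, while the right-hand side vanishes.
  have hexp : ∀ n : Fin 3 → ℤ, n ≠ 0 → ∫ x, cellExp n x * φ x ∂cellMeasure = 0 := by
    intro n hn
    obtain ⟨j, hj⟩ := Function.ne_iff.1 hn
    have h1 := h.integral_eq j _ (isSmoothPeriodic_cellExp n)
    have h2 : ∫ x, g x j * cellExp n x ∂cellMeasure = 0 :=
      integral_eq_zero_of_ae ((hg j).mono fun x hx => by simp [hx])
    have h3 : ∀ x, φ x * partialDeriv j (cellExp n) x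
        = (2 * Real.pi * Complex.I * n j) * (cellExp n x * φ x) := fun x => by
      rw [partialDeriv_cellExp]; ring
    simp only [h3] at h1
    rw [integral_const_mul, h2, neg_zero] at h1
    refine (mul_eq_zero.1 h1).resolve_left ?_
    have : (n j : ℂ) ≠ 0 := by exact_mod_cast hj
    simp [this, Real.pi_ne_zero]
  have hlift := measurePreserving_torusLift
  have hΦ : MemLp (φ ∘ torusLift) 2 volume := h.memLp.comp_measurePreserving hlift
  have hcoeff : ∀ n : Fin 3 → ℤ, n ≠ 0 →
      UnitAddTorus.mFourierCoeff (hΦ.toLp (φ ∘ torusLift)) n = 0 := by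
    intro n hn
    have h1 : UnitAddTorus.mFourierCoeff (hΦ.toLp (φ ∘ torusLift)) n
        = ∫ t, (fun x => cellExp (-n) x * φ x) (torusLift t) := by
      refine integral_congr_ae ?_
      filter_upwards [hΦ.coeFn_toLp] with t ht
      rw [ht, mFourier_eq_cellExp]
      rfl
    have h2 : AEStronglyMeasurable (fun x => cellExp (-n) x * φ x)
        (Measure.map torusLift volume) := by
      rw [hlift.map_eq]
      exact ((isSmoothPeriodic_cellExp (-n)).1.continuous.aestronglyMeasurable).mul h.memLp.1
    rw [h1, ← integral_map hlift.measurable.aemeasurable h2, hlift.map_eq,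
      hexp _ (neg_ne_zero.2 hn)]
  have hsum := UnitAddTorus.hasSum_mFourier_series_L2 (hΦ.toLp (φ ∘ torusLift))
  have hsingle := hasSum_single (f := fun n => UnitAddTorus.mFourierCoeff
    (hΦ.toLp (φ ∘ torusLift)) n • UnitAddTorus.mFourierLp 2 n) 0
    fun n hn => by rw [hcoeff n hn, zero_smul]
  have heq := hsum.unique hsingle
  set b := UnitAddTorus.mFourierCoeff (hΦ.toLp (φ ∘ torusLift)) 0 with hb
  refine ⟨b, ?_⟩
  have hae : ∀ᵐ t : UnitAddTorus (Fin 3), φ (torusLift t) = b := by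
    have h1 := Lp.coeFn_smul b (UnitAddTorus.mFourierLp (d := Fin 3) 2 0)
    rw [← heq] at h1
    filter_upwards [hΦ.coeFn_toLp, h1, UnitAddTorus.coeFn_mFourierLp 2 (0 : Fin 3 → ℤ)]
      with t h2 h3 h4
    rw [h2, Pi.smul_apply, h4, UnitAddTorus.mFourier_zero] at h3
    simpa using h3
  have hmeas : AEStronglyMeasurable (fun x => φ x - b) cellMeasure :=
    h.memLp.1.sub aestronglyMeasurable_const
  have hzero : eLpNorm (fun x => φ x - b) 2 cellMeasure = 0 := by
    rw [← eLpNorm_comp_measurePreserving hmeas hlift]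
    refine (eLpNorm_congr_ae (hae.mono fun t ht => ?_)).trans eLpNorm_zero
    simp [ht]
  filter_upwards [(eLpNorm_eq_zero_iff hmeas two_ne_zero).1 hzero] with x hx
  exact sub_eq_zero.1 hx

end Periodic

/-! ### The sesquilinear energy form -/

section EnergyForm

variable {m n : Type*} [Fintype m] [Fintype n] {μ : Measure E3}

/-- The sesquilinear form of a field of matrices. -/
noncomputable def energyForm (μ : Measure E3) (A : E3 → Matrix m m ℂ) (G H : E3 → Matrix m n ℂ) :
    ℂ :=
  ∫ x, frobInner (A x * G x) (H x) ∂μ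

theorem frobInner_sub_left (A A' B : Matrix m n ℂ) :
    frobInner (A - A') B = frobInner A B - frobInner A' B := by
  simp [frobInner, sub_mul, Finset.sum_sub_distrib]

theorem frobInner_sub_right (A B B' : Matrix m n ℂ) :
    frobInner A (B - B') = frobInner A B - frobInner A B' := by
  simp [frobInner, mul_sub, Finset.sum_sub_distrib]

theorem frobNorm_smul (z : ℂ) (A : Matrix m n ℂ) : frobNorm (z • A) = ‖z‖ * frobNorm A := by
  rw [frobNorm, frobNorm, ← Real.sqrt_sq (norm_nonneg z), ← Real.sqrt_mul (by positivity)]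
  simp only [Matrix.smul_apply, smul_eq_mul, norm_mul, mul_pow, Finset.mul_sum]

omit [Fintype m] [Fintype n] in
theorem MatrixMemLp.sub {r : ℝ≥0∞} {G H : E3 → Matrix m n ℂ} (hG : MatrixMemLp G r μ)
    (hH : MatrixMemLp H r μ) : MatrixMemLp (fun x => G x - H x) r μ :=
  fun i j => (hG i j).sub (hH i j)

/-- The inhomogeneity `M` cancels, and only `G` and `G'` occur as test fields. Two correctors can
thus be compared without making their difference an element of the test space, trace included. -/
theorem energyForm_sub_sub {A : E3 → Matrix m m ℂ} {M G G' : E3 → Matrix m n ℂ}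
    (hA : MatrixMemLp A ∞ μ) (hM : MatrixMemLp M 2 μ) (hG : MatrixMemLp G 2 μ)
    (hG' : MatrixMemLp G' 2 μ) :
    energyForm μ A (fun x => G x - G' x) (fun x => G x - G' x)
      = energyForm μ A (fun x => M x + G x) G - energyForm μ A (fun x => M x + G' x) G
        - (energyForm μ A (fun x => M x + G x) G' - energyForm μ A (fun x => M x + G' x) G') := by
  have h1 := hA.mul (hM.add hG)
  have h2 := hA.mul (hM.add hG')
  have i1 := integrable_frobInner h1 hG
  have i2 := integrable_frobInner h2 hG
  have i3 := integrable_frobInner h1 hG'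
  have i4 := integrable_frobInner h2 hG'
  unfold energyForm
  rw [← integral_sub i1 i2, ← integral_sub i3 i4, ← integral_sub]
  · refine integral_congr_ae (ae_of_all _ fun x => ?_)
    simp only
    rw [frobInner_sub_right, ← frobInner_sub_left, ← frobInner_sub_left, ← Matrix.mul_sub,
      add_sub_add_left_eq_sub]
  · exact i1.sub i2
  · exact i3.sub i4

theorem le_re_energyForm {A : E3 → Matrix m m ℂ} {G : E3 → Matrix m n ℂ} {α : ℝ}
    (hA : MatrixMemLp A ∞ μ) (hG : MatrixMemLp G 2 μ)
    (h : ∀ᵐ x ∂μ, α * frobNorm (G x) ^ 2 ≤ (frobInner (A x * G x) (G x)).re) :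
    α * ∫ x, frobNorm (G x) ^ 2 ∂μ ≤ (energyForm μ A G G).re := by
  have hi := integrable_frobInner (hA.mul hG) hG
  rw [energyForm, ← integral_const_mul,
    show (∫ x, frobInner (A x * G x) (G x) ∂μ).re
      = ∫ x, (frobInner (A x * G x) (G x)).re ∂μ from (integral_re hi).symm]
  exact integral_mono_ae (hG.memLp_frobNorm.integrable_sq.const_mul α) hi.re h

theorem ae_entry_eq_zero {G : E3 → Matrix m n ℂ} (hG : MatrixMemLp G 2 μ)
    (h : ∫ x, frobNorm (G x) ^ 2 ∂μ ≤ 0) (i : m) (j : n) : ∀ᵐ x ∂μ, G x i j = 0 := by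
  have h0 := (integral_eq_zero_iff_of_nonneg (fun x => sq_nonneg (frobNorm (G x)))
    hG.memLp_frobNorm.integrable_sq).1 (le_antisymm h (integral_nonneg fun x => sq_nonneg _))
  filter_upwards [h0] with x hx
  have hx' : frobNorm (G x) = 0 := by simpa using hx
  exact norm_le_zero_iff.1 (hx' ▸ norm_entry_le_frobNorm (G x) i j)

end EnergyForm

/-! ### Boundedness and coercivity of the transformed tensors -/

section Coefficients

variable {S : Set E3} {τ : Fin 2 → E3 → E3} {δ c : ℝ} {L : ℝ≥0} {q : E3 → E3}
  {ε σ : E3 → Matrix (Fin 3) (Fin 3) ℂ}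

theorem defGrad_transpose_mul (hδ : 0 < δ) {x : E3} (h : δ ≤ defDet q x) :
    (defGrad q x)ᵀ * (defGrad q x)⁻¹ᵀ = 1 := by
  have hu : IsUnit (defGrad q x).det := isUnit_iff_ne_zero.2 (hδ.trans_le h).ne'
  rw [← Matrix.transpose_mul, Matrix.nonsing_inv_mul _ hu, Matrix.transpose_one]

/-- The coefficient of the bulk term. -/
theorem neg_I_smul_hatPermittivity (x : E3) :
    (-Complex.I) • hatPermittivity ε q x
      = ((defDet q x : ℝ) : ℂ) • ((toComplex (defGrad q x)⁻¹ᵀ)ᵀ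
        * ((-Complex.I) • ε (deform q x)) * toComplex (defGrad q x)⁻¹ᵀ) := by
  rw [hatPermittivity, toComplex_transpose, Matrix.transpose_transpose, Matrix.mul_smul,
    Matrix.smul_mul, smul_comm]

theorem IsDeformation.ae_abs_defGrad_le (hq : IsDeformation S τ δ L q) :
    ∀ᵐ x ∂cellMeasure, ∀ i j, |defGrad q x i j| ≤ 1 + L :=
  ae_cellMeasure_mem_interior.mono fun _ hx i j => abs_defGrad_le hq.lipschitz hx i j

theorem IsDeformation.memLp_defGrad (hq : IsDeformation S τ δ L q) (i j : Fin 3) :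
    MemLp (fun x => defGrad q x i j) ∞ cellMeasure :=
  memLp_top_continuous_comp_matrix (A := defGrad q) (g := fun M => M i j) (by fun_prop)
    (fun i j => (measurable_defGrad q i j).aestronglyMeasurable) hq.ae_abs_defGrad_le

theorem IsDeformation.memLp_defDet (hq : IsDeformation S τ δ L q) :
    MemLp (defDet q) ∞ cellMeasure :=
  memLp_top_continuous_comp_matrix (A := defGrad q) (g := fun M => M.det) (by fun_prop)
    (fun i j => (measurable_defGrad q i j).aestronglyMeasurable) hq.ae_abs_defGrad_le

/-- Cramer's rule: the adjugate is polynomial in bounded entries, and `1/J ≤ 1/δ`. -/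
theorem IsDeformation.memLp_defGrad_inv (hδ : 0 < δ) (hq : IsDeformation S τ δ L q)
    (i j : Fin 3) : MemLp (fun x => (defGrad q x)⁻¹ᵀ i j) ∞ cellMeasure := by
  have h1 : MemLp (fun x => (defGrad q x).adjugate j i) ∞ cellMeasure :=
    memLp_top_continuous_comp_matrix (A := defGrad q) (g := fun M => M.adjugate j i)
      ((continuous_id.matrix_adjugate).matrix_elem j i)
      (fun i j => (measurable_defGrad q i j).aestronglyMeasurable) hq.ae_abs_defGrad_le
  have h2 : MemLp (fun x => (defDet q x)⁻¹) ∞ cellMeasure :=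
    memLp_top_inv hq.memLp_defDet.1 hδ hq.le_det
  have h3 : MemLp (fun x => (defDet q x)⁻¹ * (defGrad q x).adjugate j i) ∞ cellMeasure := h1.mul h2
  refine h3.ae_eq (ae_of_all _ fun x => ?_)
  simp [Matrix.inv_def, defDet]

theorem IsDeformation.memLp_permittivity (hq : IsDeformation S τ δ L q)
    (hε : IsPermittivity c q ε) :
    MatrixMemLp (fun x => (-Complex.I) • ε (deform q x)) ∞ cellMeasure := by
  have hy : AEMeasurable (deform q) cellMeasure :=
    (continuousOn_deform hq.lipschitz).aemeasurable measurableSet_unitCell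
  obtain ⟨M, hM⟩ := hε.bounded
  exact (MatrixMemLp.of_bound
    (fun i j => ((hε.measurable i j).comp_aemeasurable hy).aestronglyMeasurable) hM).const_smul _

theorem IsDeformation.memLp_hatPermittivity (hδ : 0 < δ) (hq : IsDeformation S τ δ L q)
    (hε : IsPermittivity c q ε) :
    MatrixMemLp (fun x => (-Complex.I) • hatPermittivity ε q x) ∞ cellMeasure := by
  simp only [neg_I_smul_hatPermittivity]
  exact (hq.memLp_permittivity hε).pullback (hq.memLp_defGrad_inv hδ) hq.memLp_defDet

theorem IsDeformation.coercive_hatPermittivity (hδ : 0 < δ) (hc : 0 < c)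
    (hq : IsDeformation S τ δ L q) (hε : IsPermittivity c q ε) :
    ∀ᵐ x ∂cellMeasure, ∀ G : Matrix (Fin 3) (Fin 3) ℂ, c * δ / (1 + L) ^ 2 * frobNorm G ^ 2
      ≤ (frobInner (((-Complex.I) • hatPermittivity ε q x) * G) G).re := by
  filter_upwards [hq.le_det, hε.symm, hε.elliptic, ae_cellMeasure_mem_interior]
    with x hx hs he hi G
  rw [neg_I_smul_hatPermittivity]
  refine coercive_pullback (B := defGrad q x) (by positivity) hc hδ.le hx ?_
    (defGrad_transpose_mul hδ hx) (defGrad_mulVec_dotProduct_le hq.lipschitz hi) (fun a => ?_) G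
  · rw [Matrix.IsSymm, Matrix.transpose_smul, hs.eq]
  · have h : ((-Complex.I) • ε (deform q x)).map Complex.re = (ε (deform q x)).map Complex.im := by
      ext i j
      simp
    rw [h]
    exact he _

theorem IsInclusion.aemeasurable_deform (hS : IsInclusion S) (hq : IsDeformation S τ δ L q) :
    AEMeasurable (deform q) (surfaceMeasure S) :=
  AEMeasurable.smul_measure (((continuousOn_deform hq.lipschitz).mono
    hS.subset_unitCell).aemeasurable hS.isCompact.measurableSet) _

/-- The lower bound of the squared singular values of the tangential deformation gradient. -/
noncomputable def tangentBound (δ : ℝ) (L : ℝ≥0) : ℝ := ((16 * (1 + L) ^ 2 / min δ 1) ^ 2)⁻¹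

theorem tangentBound_pos (hδ : 0 < δ) : 0 < tangentBound δ L := by
  have hmin : 0 < min δ 1 := lt_min hδ one_pos
  have hL : (0 : ℝ) ≤ L := L.2
  unfold tangentBound
  positivity

theorem IsDeformation.ae_le_det_tangentMatrix (hS : IsInclusion S) (hτ : IsTangentFrame S τ)
    (hδ : 0 < δ) (hq : IsDeformation S τ δ L q) :
    ∀ᵐ p ∂surfaceMeasure S,
      tangentBound δ L ^ 2 ≤ ((tangentMatrix S τ q p)ᵀ * tangentMatrix S τ q p).det :=
  (hq.tangentMatrix_bounds hS hτ hδ).mono fun _ hp =>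
    sq_le_det_transpose_mul_self (tangentBound_pos hδ).le fun a => (hp a).1

theorem IsDeformation.ae_abs_tangentMatrix_le (hS : IsInclusion S) (hτ : IsTangentFrame S τ)
    (hδ : 0 < δ) (hq : IsDeformation S τ δ L q) :
    ∀ᵐ p ∂surfaceMeasure S, ∀ i j, |tangentMatrix S τ q p i j| ≤ 1 + L := by
  filter_upwards [hq.tangentMatrix_bounds hS hτ hδ] with p hp i j
  refine abs_le_of_sq_le_sq ?_ (by positivity)
  have h1 := (hp (Pi.single j 1)).2
  simp only [Matrix.mulVec_single_one, dotProduct_single_one, Pi.single_eq_same, mul_one] at h1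
  refine le_trans ?_ h1
  rw [sq]
  exact Finset.single_le_sum
    (f := fun i => (tangentMatrix S τ q p).col j i * (tangentMatrix S τ q p).col j i)
    (fun _ _ => mul_self_nonneg _) (Finset.mem_univ i)

theorem IsDeformation.memLp_comp_tangentMatrix (hS : IsInclusion S) (hτ : IsTangentFrame S τ)
    (hδ : 0 < δ) (hq : IsDeformation S τ δ L q) {g : Matrix (Fin 3) (Fin 2) ℝ → ℝ}
    (hg : Continuous g) : MemLp (fun p => g (tangentMatrix S τ q p)) ∞ (surfaceMeasure S) :=
  memLp_top_continuous_comp_matrix hg (hq.aestronglyMeasurable_tangentMatrix hτ)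
    (hq.ae_abs_tangentMatrix_le hS hτ hδ)

theorem IsDeformation.memLp_dualTangentMatrix (hS : IsInclusion S) (hτ : IsTangentFrame S τ)
    (hδ : 0 < δ) (hq : IsDeformation S τ δ L q) (i : Fin 3) (k : Fin 2) :
    MemLp (fun p => dualTangentMatrix (tangentMatrix S τ q p) i k) ∞ (surfaceMeasure S) := by
  have h1 := hq.memLp_comp_tangentMatrix hS hτ hδ (g := fun B => (B * (Bᵀ * B).adjugate) i k)
    ((continuous_id.matrix_mul ((continuous_id.matrix_transpose.matrix_mul
      continuous_id).matrix_adjugate)).matrix_elem i k)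
  have h2 := hq.memLp_comp_tangentMatrix hS hτ hδ (g := fun B => (Bᵀ * B).det)
    ((continuous_id.matrix_transpose.matrix_mul continuous_id).matrix_det)
  have h3 := memLp_top_inv h2.1 (pow_pos (tangentBound_pos hδ) 2)
    (hq.ae_le_det_tangentMatrix hS hτ hδ)
  have h4 : MemLp (fun p => (((tangentMatrix S τ q p)ᵀ * tangentMatrix S τ q p).det)⁻¹
      * (tangentMatrix S τ q p * ((tangentMatrix S τ q p)ᵀ * tangentMatrix S τ q p).adjugate) i k)
      ∞ (surfaceMeasure S) := h1.mul h3
  refine h4.ae_eq (ae_of_all _ fun p => ?_)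
  simp only [dualTangentMatrix, Matrix.inv_def, Matrix.mul_smul, Matrix.smul_apply, smul_eq_mul,
    Ring.inverse_eq_inv']

theorem IsDeformation.memLp_areaFactor (hS : IsInclusion S) (hτ : IsTangentFrame S τ)
    (hδ : 0 < δ) (hq : IsDeformation S τ δ L q) :
    MemLp (fun p => areaFactor (tangentMatrix S τ q p)) ∞ (surfaceMeasure S) :=
  hq.memLp_comp_tangentMatrix hS hτ hδ (g := areaFactor) <|
    Real.continuous_sqrt.comp
      ((continuous_id.matrix_transpose.matrix_mul continuous_id).matrix_det)

theorem IsDeformation.memLp_hatConductivity (hS : IsInclusion S) (hτ : IsTangentFrame S τ)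
    (hδ : 0 < δ) (hq : IsDeformation S τ δ L q) (hσ : IsConductivity c S τ q σ) :
    MatrixMemLp (hatConductivity σ S τ q) ∞ (surfaceMeasure S) := by
  obtain ⟨M, hM⟩ := hσ.bounded
  have h : MatrixMemLp (fun p => σ (deform q p)) ∞ (surfaceMeasure S) := MatrixMemLp.of_bound
    (fun i j => ((hσ.measurable i j).comp_aemeasurable
      (hS.aemeasurable_deform hq)).aestronglyMeasurable) hM
  exact h.pullback (hq.memLp_dualTangentMatrix hS hτ hδ) (hq.memLp_areaFactor hS hτ hδ)

/-- The bound `det (BᵀB) ≥ r²` with `r = tangentBound δ L` gives `κ ≥ r`. Ellipticity on tangent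
vectors suffices, since `D a = B ((BᵀB)⁻¹ a)` lies in the range of `B`. -/
theorem IsDeformation.coercive_hatConductivity (hS : IsInclusion S) (hτ : IsTangentFrame S τ)
    (hδ : 0 < δ) (hc : 0 < c) (hq : IsDeformation S τ δ L q) (hσ : IsConductivity c S τ q σ) :
    ∀ᵐ p ∂surfaceMeasure S, ∀ G : Matrix (Fin 2) (Fin 3) ℂ,
      c * tangentBound δ L / (1 + L) ^ 2 * frobNorm G ^ 2
        ≤ (frobInner (hatConductivity σ S τ q p * G) G).re := by
  have hr := tangentBound_pos (L := L) hδ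
  filter_upwards [hq.tangentMatrix_bounds hS hτ hδ, hq.ae_le_det_tangentMatrix hS hτ hδ, hσ.symm,
    hσ.elliptic] with p hp hdet hs he G
  refine coercive_pullback (B := tangentMatrix S τ q p) (by positivity) hc hr.le
    (Real.le_sqrt_of_sq_le hdet) hs
    (transpose_mul_dualTangentMatrix ((pow_pos hr 2).trans_le hdet).ne') (fun a => (hp a).2)
    (fun a => he _ ⟨((tangentMatrix S τ q p)ᵀ * tangentMatrix S τ q p)⁻¹ *ᵥ a, ?_⟩) G
  rw [dualTangentMatrix, Matrix.mulVec_mulVec]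

end Coefficients

/-! ### The cell problem in reference coordinates -/

section CellProblem

variable {S : Set E3} {τ : Fin 2 → E3 → E3} {δ c ω : ℝ} {L : ℝ≥0} {q : E3 → E3}
  {ε σ : E3 → Matrix (Fin 3) (Fin 3) ℂ}

theorem memLp_gradMatrix (χ : Fin 3 → HFunction S τ) :
    MatrixMemLp (gradMatrix χ) 2 cellMeasure := fun a i => (χ i).hasGrad.memLp_grad a

theorem memLp_tgradMatrix (χ : Fin 3 → HFunction S τ) :
    MatrixMemLp (tgradMatrix χ) 2 (surfaceMeasure S) := fun k i => (χ i).hasTgrad.1 k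

theorem IsDeformation.memLp_defGrad_transpose (hq : IsDeformation S τ δ L q) :
    MatrixMemLp (fun x => toComplex (defGrad q x)ᵀ) 2 cellMeasure := fun i j =>
  ((hq.memLp_defGrad j i).mono_exponent le_top).ofReal

theorem IsDeformation.memLp_tangentMatrix_transpose (hS : IsInclusion S)
    (hτ : IsTangentFrame S τ) (hδ : 0 < δ) (hq : IsDeformation S τ δ L q) :
    MatrixMemLp (fun p => toComplex (tangentMatrix S τ q p)ᵀ) 2 (surfaceMeasure S) := fun i j => by
  have : Fact (IsInclusion S) := ⟨hS⟩
  have h : MemLp (fun p => tangentMatrix S τ q p j i) ∞ (surfaceMeasure S) :=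
    hq.memLp_comp_tangentMatrix hS hτ hδ (g := fun B => B j i) (by fun_prop)
  exact (h.mono_exponent le_top).ofReal

/-- The form of the cell problem in terms of the transformed tensors. -/
theorem IsDeformation.neg_I_mul_cellForm (hδ : 0 < δ) (hq : IsDeformation S τ δ L q)
    (χ φ : Fin 3 → HFunction S τ) :
    -Complex.I * cellForm ω ε σ S τ q χ φ
      = energyForm cellMeasure (fun x => (-Complex.I) • hatPermittivity ε q x)
          (fun x => toComplex (defGrad q x)ᵀ + gradMatrix χ x) (gradMatrix φ)
        + ((1 / ω : ℝ) : ℂ) * energyForm (surfaceMeasure S) (hatConductivity σ S τ q)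
          (fun p => toComplex (tangentMatrix S τ q p)ᵀ + tgradMatrix χ p) (tgradMatrix φ) := by
  have hI : -Complex.I * -(1 / (Complex.I * ω)) = ((1 / ω : ℝ) : ℂ) := by
    push_cast
    rcases eq_or_ne ω 0 with rfl | hω
    · simp
    · have : (ω : ℂ) ≠ 0 := by exact_mod_cast hω
      field_simp
  rw [cellForm, sub_eq_add_neg, mul_add, ← neg_mul, ← mul_assoc, hI, energyForm, energyForm,
    ← integral_const_mul]
  congr 1
  · refine integral_congr_ae ?_
    filter_upwards [hq.le_det] with x hx
    -- Writing the unit matrix as `F⁻ᵀ Fᵀ` is what makes `Fᵀ` the source term. It needs `J ≠ 0`, so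
    -- the bulk integrands agree only a.e.; on the surface the source is already given as `D Bᵀ`.
    have h1 : (1 : Matrix (Fin 3) (Fin 3) ℂ)
        = toComplex (defGrad q x)⁻¹ᵀ * toComplex (defGrad q x)ᵀ := by
      rw [← toComplex_mul, mul_eq_one_comm.1 (defGrad_transpose_mul hδ hx), toComplex_one]
    rw [neg_I_smul_hatPermittivity, ← frobInner_pullback, ← h1, Matrix.smul_mul,
      frobInner_smul_left, mul_assoc]
  · congr 1
    refine integral_congr_ae (ae_of_all _ fun p => ?_)
    simp only
    rw [hatConductivity, ← frobInner_pullback, toComplex_mul]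

theorem memLp_two_of_continuous {f : E3 → ℂ} (hf : Continuous f) : MemLp f 2 cellMeasure := by
  obtain ⟨C, hC⟩ := isCompact_unitCell.exists_bound_of_continuousOn hf.continuousOn
  exact MemLp.of_bound hf.aestronglyMeasurable C
    ((ae_restrict_mem measurableSet_unitCell).mono hC)

/-- Smooth periodic test functions and their derivatives are bounded on the cell, so all four
products are integrable and the integrals split. -/
theorem HasPeriodicWeakGradient.sub {φ φ' : E3 → ℂ} {g g' : E3 → Fin 3 → ℂ}
    (h : HasPeriodicWeakGradient φ g) (h' : HasPeriodicWeakGradient φ' g') :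
    HasPeriodicWeakGradient (fun x => φ x - φ' x) (fun x j => g x j - g' x j) where
  memLp := h.memLp.sub h'.memLp
  memLp_grad j := (h.memLp_grad j).sub (h'.memLp_grad j)
  integral_eq j ψ hψ := by
    have h1 := memLp_two_of_continuous hψ.1.continuous
    have h2 : MemLp (partialDeriv j ψ) 2 cellMeasure := memLp_two_of_continuous
      ((hψ.1.continuous_fderiv (by simp)).clm_apply continuous_const)
    simp only [sub_mul]
    rw [integral_sub, integral_sub, h.integral_eq j ψ hψ, h'.integral_eq j ψ hψ]
    · ring
    · exact (h.memLp_grad j).integrable_mul h1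
    · exact (h'.memLp_grad j).integrable_mul h1
    · exact h.memLp.integrable_mul h2
    · exact h'.memLp.integrable_mul h2

theorem matrixNorm_neg_I_smul {m n : Type*} [Fintype m] [Fintype n] (A : E3 → Matrix m n ℂ)
    (r : ℝ≥0∞) (μ : Measure E3) :
    matrixNorm (fun x => (-Complex.I) • A x) r μ = matrixNorm A r μ := by
  simp only [matrixNorm, frobNorm_smul, norm_neg, Complex.norm_I, one_mul]

end CellProblem

/-! ### The a priori estimate and uniqueness up to constants -/

theorem mainTheorem2 (S : Set E3) (hS : IsInclusion S) (δ : ℝ) (hδ : 0 < δ)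
    (c : ℝ) (hc : 0 < c) (L : ℝ≥0) :
    ∃ C : ℝ, 0 < C ∧
      ∀ (τ : Fin 2 → E3 → E3), IsTangentFrame S τ →
      ∀ (q : E3 → E3), IsDeformation S τ δ L q →
      ∀ (ε σ : E3 → Matrix (Fin 3) (Fin 3) ℂ), IsPermittivity c q ε → IsConductivity c S τ q σ →
      ∀ (ω : ℝ), 0 < ω →
        (∀ χ : Fin 3 → HFunction S τ, IsCorrector ω ε σ S τ q χ →
          matrixNorm (gradMatrix χ) 2 cellMeasure ^ 2
              + ENNReal.ofReal (1 / ω) * matrixNorm (tgradMatrix χ) 2 (surfaceMeasure S) ^ 2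
            ≤ ENNReal.ofReal C *
              (matrixNorm (hatPermittivity ε q) ∞ cellMeasure ^ 2
                  * matrixNorm (fun x => toComplex (defGrad q x)ᵀ) 2 cellMeasure ^ 2
                + ENNReal.ofReal (1 / ω)
                  * matrixNorm (hatConductivity σ S τ q) ∞ (surfaceMeasure S) ^ 2
                  * matrixNorm (fun p => toComplex (tangentMatrix S τ q p)ᵀ) 2
                      (surfaceMeasure S) ^ 2)) ∧
        (∀ χ χ' : Fin 3 → HFunction S τ,
          IsCorrector ω ε σ S τ q χ → IsCorrector ω ε σ S τ q χ' →
          ∃ b : Fin 3 → ℂ, ∀ i, ∀ᵐ x ∂cellMeasure, (χ i).toFun x = (χ' i).toFun x + b i) := by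
  -- The smaller of the bulk and surface coercivity constants; a common value makes the two energy
  -- inequalities add up with the weight `1/ω`, so that `ω` does not enter `C`.
  set γ : ℝ := min (c * δ / (1 + L) ^ 2) (c * tangentBound δ L / (1 + L) ^ 2) with hγ
  have hr := tangentBound_pos (L := L) hδ
  have hγ0 : 0 < γ := lt_min (by positivity) (by positivity)
  refine ⟨1 / γ ^ 2, by positivity, fun τ hτ q hq ε σ hε hσ ω hω => ?_⟩
  have hA₁ := hq.memLp_hatPermittivity hδ hε
  have hA₂ := hq.memLp_hatConductivity hS hτ hδ hσ
  have hM₁ := hq.memLp_defGrad_transpose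
  have hM₂ := hq.memLp_tangentMatrix_transpose hS hτ hδ
  have hco₁ : ∀ᵐ x ∂cellMeasure, ∀ G : Matrix (Fin 3) (Fin 3) ℂ, γ * frobNorm G ^ 2
      ≤ (frobInner (((-Complex.I) • hatPermittivity ε q x) * G) G).re :=
    (hq.coercive_hatPermittivity hδ hc hε).mono fun x hx G =>
      (mul_le_mul_of_nonneg_right (min_le_left _ _) (sq_nonneg _)).trans (hx G)
  have hco₂ : ∀ᵐ p ∂surfaceMeasure S, ∀ G : Matrix (Fin 2) (Fin 3) ℂ, γ * frobNorm G ^ 2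
      ≤ (frobInner (hatConductivity σ S τ q p * G) G).re :=
    (hq.coercive_hatConductivity hS hτ hδ hc hσ).mono fun p hp G =>
      (mul_le_mul_of_nonneg_right (min_le_right _ _) (sq_nonneg _)).trans (hp G)
  have hω' : 0 < 1 / ω := by positivity
  constructor
  · intro χ hχ
    have hG₁ := memLp_gradMatrix χ
    have hG₂ := memLp_tgradMatrix χ
    have h0 := hq.neg_I_mul_cellForm (ω := ω) (ε := ε) (σ := σ) hδ χ χ
    rw [hχ χ, mul_zero] at h0
    have hre := congrArg Complex.re h0
    rw [Complex.zero_re, Complex.add_re, Complex.re_ofReal_mul] at hre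
    have h1 := energy_le hγ0 hA₁ hM₁ hG₁ (hco₁.mono fun x hx => hx _)
    have h2 := energy_le hγ0 hA₂ hM₂ hG₂ (hco₂.mono fun x hx => hx _)
    have hN₁ := hA₁.memLp_frobNorm.eLpNorm_ne_top
    have hN₂ := hA₂.memLp_frobNorm.eLpNorm_ne_top
    change matrixNorm _ _ _ ≠ ∞ at hN₁ hN₂
    rw [matrixNorm_neg_I_smul] at h1 hN₁
    rw [matrixNorm_two_sq hG₁, matrixNorm_two_sq hG₂, matrixNorm_two_sq hM₁,
      matrixNorm_two_sq hM₂, ← ENNReal.ofReal_toReal hN₁, ← ENNReal.ofReal_toReal hN₂]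
    set X := ∫ x, frobNorm (gradMatrix χ x) ^ 2 ∂cellMeasure
    set Z := ∫ x, frobNorm (tgradMatrix χ x) ^ 2 ∂surfaceMeasure S
    set m₁ := ∫ x, frobNorm (toComplex (defGrad q x)ᵀ) ^ 2 ∂cellMeasure
    set m₂ := ∫ x, frobNorm (toComplex (tangentMatrix S τ q x)ᵀ) ^ 2 ∂surfaceMeasure S
    set n₁ := (matrixNorm (hatPermittivity ε q) ∞ cellMeasure).toReal
    set n₂ := (matrixNorm (hatConductivity σ S τ q) ∞ (surfaceMeasure S)).toReal
    have hX : 0 ≤ X := integral_nonneg fun _ => sq_nonneg _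
    have hZ : 0 ≤ Z := integral_nonneg fun _ => sq_nonneg _
    have hm₁ : 0 ≤ m₁ := integral_nonneg fun _ => sq_nonneg _
    have hm₂ : 0 ≤ m₂ := integral_nonneg fun _ => sq_nonneg _
    have hn₁ : 0 ≤ n₁ := ENNReal.toReal_nonneg
    have hn₂ : 0 ≤ n₂ := ENNReal.toReal_nonneg
    rw [← ENNReal.ofReal_pow hn₁, ← ENNReal.ofReal_pow hn₂, ← ENNReal.ofReal_mul hω'.le,
      ← ENNReal.ofReal_mul hω'.le, ← ENNReal.ofReal_mul (by positivity),
      ← ENNReal.ofReal_mul (by positivity), ← ENNReal.ofReal_add hX (by positivity),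
      ← ENNReal.ofReal_add (by positivity) (by positivity), ← ENNReal.ofReal_mul (by positivity)]
    refine ENNReal.ofReal_le_ofReal ?_
    have h3 := mul_le_mul_of_nonneg_left h2 hω'.le
    -- The two energies, the second weighted by `1/ω`, have real parts summing to zero, so the two
    -- lower bounds add up to something nonpositive.
    have h4 : γ / 2 * (X + 1 / ω * Z)
        ≤ 1 / (2 * γ) * (n₁ ^ 2 * m₁ + 1 / ω * n₂ ^ 2 * m₂) := by
      unfold energyForm at hre
      linarith
    calc X + 1 / ω * Z = 2 / γ * (γ / 2 * (X + 1 / ω * Z)) := by field_simp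
      _ ≤ 2 / γ * (1 / (2 * γ) * (n₁ ^ 2 * m₁ + 1 / ω * n₂ ^ 2 * m₂)) := by gcongr
      _ = 1 / γ ^ 2 * (n₁ ^ 2 * m₁ + 1 / ω * n₂ ^ 2 * m₂) := by field_simp
  · intro χ χ' hχ hχ'
    have hD₁ := (memLp_gradMatrix χ).sub (memLp_gradMatrix χ')
    have hD₂ := (memLp_tgradMatrix χ).sub (memLp_tgradMatrix χ')
    have hform : ∀ {η : Fin 3 → HFunction S τ}, IsCorrector ω ε σ S τ q η →
        ∀ φ, _ := fun {η} hη φ =>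
      (hq.neg_I_mul_cellForm (ω := ω) (ε := ε) (σ := σ) hδ η φ).symm.trans
        (by rw [hη φ, mul_zero] : _ = (0 : ℂ))
    have h1 := energyForm_sub_sub hA₁ hM₁ (memLp_gradMatrix χ) (memLp_gradMatrix χ')
    have h2 := energyForm_sub_sub hA₂ hM₂ (memLp_tgradMatrix χ) (memLp_tgradMatrix χ')
    have h0 : energyForm cellMeasure (fun x => (-Complex.I) • hatPermittivity ε q x)
          (fun x => gradMatrix χ x - gradMatrix χ' x) (fun x => gradMatrix χ x - gradMatrix χ' x)
        + ((1 / ω : ℝ) : ℂ) * energyForm (surfaceMeasure S) (hatConductivity σ S τ q)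
          (fun p => tgradMatrix χ p - tgradMatrix χ' p)
          (fun p => tgradMatrix χ p - tgradMatrix χ' p) = 0 := by
      rw [h1, h2]
      -- Each corrector's equation is tested with both correctors.
      linear_combination hform hχ χ - hform hχ' χ - hform hχ χ' + hform hχ' χ'
    have hre := congrArg Complex.re h0
    rw [Complex.zero_re, Complex.add_re, Complex.re_ofReal_mul] at hre
    have h3 := le_re_energyForm hA₁ hD₁ (hco₁.mono fun x hx => hx _)
    have h4 := le_re_energyForm hA₂ hD₂ (hco₂.mono fun x hx => hx _)
    -- The surface energy is only needed to be nonnegative: it can be dropped, and the bulk energy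
    -- alone forces the gradients to agree.
    have h5 : 0 ≤ γ * ∫ p, frobNorm (tgradMatrix χ p - tgradMatrix χ' p) ^ 2 ∂surfaceMeasure S :=
      mul_nonneg hγ0.le (integral_nonneg fun _ => sq_nonneg _)
    have h6 := mul_nonneg hω'.le (h5.trans h4)
    have h7 : ∫ x, frobNorm (gradMatrix χ x - gradMatrix χ' x) ^ 2 ∂cellMeasure ≤ 0 := by
      by_contra! hpos
      linarith [mul_pos hγ0 hpos]
    have hconst : ∀ i, ∃ b : ℂ, ∀ᵐ x ∂cellMeasure, (χ i).toFun x - (χ' i).toFun x = b := fun i =>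
      ((χ i).hasGrad.sub (χ' i).hasGrad).ae_eq_const fun j => ae_entry_eq_zero hD₁ h7 j i
    choose b hb using hconst
    exact ⟨b, fun i => (hb i).mono fun x hx => by rw [← hx]; ring⟩
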